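/- A seller has $K\ge 1$ identical copies of an item and faces $n$ buyers, each wanting one copy. The values $v_1,\dots,v_n\ge 0$ of the buyers are independent, and each $v_i$ has a known distribution with finite support. A decision tree of take-it-or-leave-it offers (a buyer and a price $\ge 0$ at each node) is an \emph{adaptive sequential posted-price mechanism} (ASPM) if each buyer gets at most one offer and the process ends exactly when $K$ copies are sold or no buyer is left; the next offer may depend on which earlier offers were accepted. Buyer $i$ accepts a price $p$ if and only if $v_i\ge p$, and then pays $p$. A \emph{sequential posted-price mechanism} (SPM) fixes an order of the buyers and a price for each buyer in advance. The expected revenue is the expected sum of the payments. (1) For every $K\ge 1$ and all such distributions there is an SPM whose expected revenue is at least $$1-\frac{K^K}{K!\,e^K}\;\ge\;1-\frac{1}{\sqrt{2\pi K}}$$ times the expected revenue of every ASPM, hence of an optimal one. (2) Such an SPM can be computed in polynomial time: there is one algorithm that, given $K\ge1$ and distributions with rational values and probabilities (all numbers written in binary), outputs such an SPM with rational prices in time polynomial in the bit length of the input. (3) Consequently, the adaptivity gap vanishes as $K$ grows: the supremum, over all $n$ and all such distributions, of the ratio between the optimal expected revenues of ASPMs and of SPMs for $K$ copies (where the ratio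 is read as $0$ if both are $0$) tends to $1$ as $K\to\infty$. -/

import Mathlib

open scoped ENNReal

noncomputable section

namespace PostedPrice

/-! ### Markets: independent buyers with finitely supported value distributions -/

/-- `n` buyers; buyer `i` has `card i` distinct possible values `value i j ≥ 0`, the value
`value i j` having probability `prob i j > 0`. Values of different buyers are independent.
The numbers are taken in `F`, which is `ℝ` in general and `ℚ` for inputs of an algorithm. -/
structure Market (F : Type) [Field F] [LinearOrder F] (n : ℕ) where
  card : Fin n → ℕ
  value : (i : Fin n) → Fin (card i) → F
  prob : (i : Fin n) → Fin (card i) → F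
  value_nonneg : ∀ i j, 0 ≤ value i j
  value_injective : ∀ i, Function.Injective (value i)
  prob_pos : ∀ i j, 0 < prob i j
  sum_prob : ∀ i, ∑ j, prob i j = 1

/-- Expectation of a function of the value profile `(v₁, …, vₙ)`. -/
def Market.expect {n : ℕ} (M : Market ℝ n) (f : (Fin n → ℝ) → ℝ) : ℝ :=
  ∑ ω : (i : Fin n) → Fin (M.card i),
    (∏ i, M.prob i (ω i)) * f (fun i => M.value i (ω i))

/-- A market with rational data, regarded as a market with real data. -/
def Market.toReal {n : ℕ} (M : Market ℚ n) : Market ℝ n where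
  card := M.card
  value i j := (M.value i j : ℝ)
  prob i j := (M.prob i j : ℝ)
  value_nonneg i j := by exact_mod_cast M.value_nonneg i j
  value_injective i := Rat.cast_injective.comp (M.value_injective i)
  prob_pos i j := by exact_mod_cast M.prob_pos i j
  sum_prob i := by exact_mod_cast M.sum_prob i

/-! ### Adaptive and non-adaptive sequential posted-price mechanisms -/

/-- Decision trees: `offer i p a b` offers price `p` to buyer `i` and continues with `a` if the
buyer accepts and with `b` if the buyer declines. -/
inductive DecisionTree (n : ℕ) : Type
  | halted : DecisionTree n
  | offer (i : Fin n) (p : ℝ) (accepted declined : DecisionTree n) : DecisionTree n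

namespace DecisionTree

/-- The total payment when the buyers have values `v`: a buyer accepts a price if and only if
it is at most the buyer's value, and pays exactly the price. -/
def revenue {n : ℕ} : DecisionTree n → (Fin n → ℝ) → ℝ
  | halted, _ => 0
  | offer i p a b, v => if p ≤ v i then p + a.revenue v else b.revenue v

/-- The tree is a selling procedure for `k` copies and the set `S` of buyers: every buyer gets at
most one offer, and the procedure ends exactly when no copy or no buyer is left. -/
def IsMechanism {n : ℕ} : DecisionTree n → ℕ → Finset (Fin n) → Prop
  | halted, k, S => k = 0 ∨ S = ∅
  | offer i p a b, k, S =>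
      0 < k ∧ i ∈ S ∧ 0 ≤ p ∧ a.IsMechanism (k - 1) (S.erase i) ∧ b.IsMechanism k (S.erase i)

/-- The tree that makes the offers of a list in the given order, whatever the answers are, until
`k` copies are sold or the list is exhausted. -/
def ofList {n : ℕ} : ℕ → List (Fin n × ℝ) → DecisionTree n
  | 0, _ => halted
  | _ + 1, [] => halted
  | k + 1, (i, p) :: l => offer i p (ofList k l) (ofList (k + 1) l)

theorem ofList_isMechanism {n : ℕ} (l : List (Fin n × ℝ)) (k : ℕ)
    (hnd : (l.map Prod.fst).Nodup) (hp : ∀ x ∈ l, 0 ≤ x.2) :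
    (ofList k l).IsMechanism k (l.map Prod.fst).toFinset := by
  induction l generalizing k with
  | nil => cases k <;> simp [ofList, IsMechanism]
  | cons x l ih =>
    obtain ⟨i, p⟩ := x
    cases k with
    | zero => simp [ofList, IsMechanism]
    | succ k =>
      simp only [List.map_cons, List.nodup_cons] at hnd
      have he : ((((i, p) :: l).map Prod.fst).toFinset).erase i = (l.map Prod.fst).toFinset := by
        rw [List.map_cons, List.toFinset_cons, Finset.erase_insert]
        simpa using hnd.1
      have hp' : ∀ x ∈ l, 0 ≤ x.2 := fun x hx => hp x (List.mem_cons_of_mem _ hx)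
      refine ⟨Nat.succ_pos _, by simp, hp (i, p) (by simp), ?_, ?_⟩
      · rw [he]; exact ih k hnd.2 hp'
      · rw [he]; exact ih (k + 1) hnd.2 hp'

end DecisionTree

/-- An adaptive sequential posted-price mechanism (ASPM) for `K` copies and `n` buyers. -/
structure ASPM (n K : ℕ) where
  tree : DecisionTree n
  isMechanism : tree.IsMechanism K Finset.univ

/-- Expected revenue of an ASPM. -/
def ASPM.expectedRevenue {n K : ℕ} (A : ASPM n K) (M : Market ℝ n) : ℝ :=
  M.expect A.tree.revenue

/-- A (non-adaptive) sequential posted-price mechanism (SPM): the `t`-th offer goes to buyer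
`order t`, and buyer `i` is offered `price i`. -/
structure SPM (F : Type) [Field F] [LinearOrder F] (n : ℕ) where
  order : Equiv.Perm (Fin n)
  price : Fin n → F
  price_nonneg : ∀ i, 0 ≤ price i

/-- An SPM with rational prices, regarded as one with real prices. -/
def SPM.toReal {n : ℕ} (S : SPM ℚ n) : SPM ℝ n where
  order := S.order
  price i := (S.price i : ℝ)
  price_nonneg i := by exact_mod_cast S.price_nonneg i

/-- The offers of an SPM, in order. -/
def SPM.offers {F : Type} [Field F] [LinearOrder F] {n : ℕ} (S : SPM F n) : List (Fin n × F) :=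
  List.ofFn fun t => (S.order t, S.price (S.order t))

theorem SPM.map_fst_offers {F : Type} [Field F] [LinearOrder F] {n : ℕ} (S : SPM F n) :
    S.offers.map Prod.fst = List.ofFn S.order := by
  simp only [SPM.offers, List.map_ofFn]
  rfl

/-- With `K` copies for sale, an SPM is an ASPM whose decisions ignore the buyers' answers. -/
def SPM.toASPM {n : ℕ} (S : SPM ℝ n) (K : ℕ) : ASPM n K where
  tree := DecisionTree.ofList K S.offers
  isMechanism := by
    have h := DecisionTree.ofList_isMechanism S.offers K
      (by rw [S.map_fst_offers]; exact List.nodup_ofFn.2 S.order.injective)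
      (by
        intro x hx
        obtain ⟨t, rfl⟩ := (List.mem_ofFn' _ _).1 hx
        exact S.price_nonneg _)
    have hu : (S.offers.map Prod.fst).toFinset = Finset.univ := by
      rw [S.map_fst_offers]
      ext i
      simpa [List.mem_ofFn] using S.order.surjective i
    rwa [hu] at h

/-- Expected revenue of an SPM when there are `K` copies for sale. -/
def SPM.expectedRevenue {n : ℕ} (S : SPM ℝ n) (K : ℕ) (M : Market ℝ n) : ℝ :=
  (S.toASPM K).expectedRevenue M

/-- The optimal expected revenue of an ASPM for `K` copies. -/
def optASPM {n : ℕ} (K : ℕ) (M : Market ℝ n) : ℝ≥0∞ :=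
  ⨆ A : ASPM n K, ENNReal.ofReal (A.expectedRevenue M)

/-- The optimal expected revenue of an SPM for `K` copies. -/
def optSPM {n : ℕ} (K : ℕ) (M : Market ℝ n) : ℝ≥0∞ :=
  ⨆ S : SPM ℝ n, ENNReal.ofReal (S.expectedRevenue K M)

/-- The adaptivity gap for `K` copies: the largest ratio between the optimal expected revenues of
ASPMs and SPMs, over all markets. (A market in which both are `0` contributes `0 / 0 = 0`.) -/
def adaptivityGap (K : ℕ) : ℝ≥0∞ :=
  ⨆ (n : ℕ) (M : Market ℝ n), optASPM K M / optSPM K M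

/-- The approximation factor `1 - K ^ K / (K! e ^ K)`. -/
def guarantee (K : ℕ) : ℝ :=
  1 - (K : ℝ) ^ K / ((K.factorial : ℝ) * Real.exp (K : ℝ))

/-! ### Programs with bit cost

A small functional programming language (primitive operations, composition, construction of
pairs, conditionals and while loops) on binary trees with natural numbers at the leaves. Every
operation, copy and test is charged the full bit length of the data that it is applied to. A
primitive operation lengthens its data by at most a constant number of bits and takes polynomial
time on a Turing machine, so polynomial cost is the same as polynomial time on a Turing
machine. -/

/-- Data: natural numbers and pairs. -/
inductive Data : Type
  | nat (k : ℕ) : Data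
  | pair (a b : Data) : Data

/-- Bit length, numbers being written in binary. -/
def Data.size : Data → ℕ
  | .nat k => k.size + 1
  | .pair a b => a.size + b.size + 1

/-- Lists as data. -/
def Data.ofList : List Data → Data
  | [] => .nat 0
  | a :: l => .pair a (Data.ofList l)

/-- Primitive operations. -/
inductive Op : Type
  | id
  | const (k : ℕ)
  | fst
  | snd
  | isPair
  | le
  | add
  | sub
  | mul
  | div

/-- Meaning of the primitive operations; arguments of the wrong shape give `0`. Subtraction is
truncated at `0`, division is rounded down, and truth values are `1` and `0`. -/
def Op.eval : Op → Data → Data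
  | .id, d => d
  | .const k, _ => .nat k
  | .fst, .pair a _ => a
  | .snd, .pair _ b => b
  | .isPair, .pair _ _ => .nat 1
  | .le, .pair (.nat a) (.nat b) => .nat (if a ≤ b then 1 else 0)
  | .add, .pair (.nat a) (.nat b) => .nat (a + b)
  | .sub, .pair (.nat a) (.nat b) => .nat (a - b)
  | .mul, .pair (.nat a) (.nat b) => .nat (a * b)
  | .div, .pair (.nat a) (.nat b) => .nat (a / b)
  | _, _ => .nat 0

/-- Programs. -/
inductive Program : Type
  | op (o : Op)
  | seq (f g : Program)
  | fork (f g : Program)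
  | cond (c f g : Program)
  | loop (c f : Program)

/-- `P.Runs x y t`: started on `x`, the program `P` halts with result `y` at cost `t`. Here
`seq f g` runs `f` and then `g`; `fork f g` runs both on a copy of the argument and pairs the
results; `cond c f g` runs `f` if the result of `c` is not `0`, and `g` otherwise; `loop c f`
applies `f` as long as the result of `c` is not `0`. -/
inductive Program.Runs : Program → Data → Data → ℕ → Prop
  | op (o : Op) (x : Data) : Runs (.op o) x (o.eval x) x.size
  | seq {f g : Program} {x y z : Data} {s t : ℕ} :
      Runs f x y s → Runs g y z t → Runs (.seq f g) x z (x.size + s + t)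
  | fork {f g : Program} {x y z : Data} {s t : ℕ} :
      Runs f x y s → Runs g x z t → Runs (.fork f g) x (.pair y z) (x.size + s + t)
  | cond_true {c f g : Program} {x b y : Data} {s t : ℕ} :
      Runs c x b s → b ≠ .nat 0 → Runs f x y t → Runs (.cond c f g) x y (x.size + s + t)
  | cond_false {c f g : Program} {x y : Data} {s t : ℕ} :
      Runs c x (.nat 0) s → Runs g x y t → Runs (.cond c f g) x y (x.size + s + t)
  | loop_stop {c f : Program} {x : Data} {s : ℕ} :
      Runs c x (.nat 0) s → Runs (.loop c f) x x (x.size + s)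
  | loop_step {c f : Program} {x b y z : Data} {s t u : ℕ} :
      Runs c x b s → b ≠ .nat 0 → Runs f x y t → Runs (.loop c f) y z u →
        Runs (.loop c f) x z (x.size + s + t + u)

/-! ### Encoding of inputs and outputs -/

/-- A non-negative rational number as numerator and denominator, in lowest terms. -/
def encodeRat (q : ℚ) : Data :=
  .pair (.nat q.num.toNat) (.nat q.den)

/-- A number of copies and a rational market: the copies, followed by the list of the buyers'
distributions, each being a list of pairs (value, probability). -/
def encodeInput {n : ℕ} (K : ℕ) (M : Market ℚ n) : Data :=
  .pair (.nat K) (Data.ofList (List.ofFn fun i : Fin n =>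
    Data.ofList (List.ofFn fun j : Fin (M.card i) =>
      .pair (encodeRat (M.value i j)) (encodeRat (M.prob i j)))))

/-- An SPM as the list of its offers (buyer, price), in order. -/
def encodeSPM {n : ℕ} (S : SPM ℚ n) : Data :=
  Data.ofList (S.offers.map fun o => .pair (.nat o.1.val) (encodeRat o.2))

end PostedPrice

end

/-!
**Upper bound.** If every copy costs `lam ≥ 0`, an adaptive mechanism earns from buyer `i` at most
the maximum over `p` of `(p - lam) * P(vᵢ ≥ p)`, because the price offered to a buyer does not
depend on that buyer's value. Hence every ASPM earns at most `K * lam` plus the sum of these maxima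
(`DecisionTree.expect_revenue_le`, an induction on the tree).

**Optimal choices.** A choice fixes for every buyer one of the buyer's values as price, or no offer.
Start with no offers, which is optimal for a large cost `lam`, and repeatedly make the change for a
single buyer with the largest gain of revenue per gain of expected sales. At this slope the choices
before and after the change are both optimal (`Market.IsOptimal.update`). Either no change gains
any revenue while the expected number of sales with unlimited supply is still at most `K`, and then
the choice is optimal for `lam = 0`; or this number passes `K` in one step, and then a mixture of
the last two choices sells exactly `K` copies on average with unlimited supply, so that its revenue
there equals the upper bound.

**Loss by limited supply.** With limited supply, offers are made in the order of decreasing prices.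
The revenue is then the integral over `θ` of the expectation of `min K N`, where `N` is the number
of acceptances of prices at least `θ` (`listRevenue_eq_integral`). In a mixture of two choices that
differ in one buyer, `N` is still a sum of independent Bernoulli variables, and its mean is at most
`K`. The expectation of `min K N` is at least that for a Poisson variable of the same mean, by
induction on the number of variables with the concavity of the latter in the mean, and at mean `K`
the Poisson value is `K * guarantee K` (`guarantee_mul_sum_le`). So the mixture earns at least
`guarantee K` times the upper bound (`guarantee_mul_mixture_le`), and so does the better one of the
two choices. Stirling's formula bounds `guarantee K` from below.

**Algorithm.** Multiplied by a common denominator, all numbers become natural numbers. The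
algorithm follows the greedy path above, computes the exact revenues of the last two choices by
dynamic programming, and outputs the better one (`bestOffers`). It is written as a function on
lists; closure properties of `PolyTime`, above all structural recursion on lists with polynomially
bounded results (`PolyTime.listRec`), turn it into a program with polynomial cost.
-/

namespace PostedPrice

/-! ### Polynomial time for functions between encoded types -/

/-- Types whose elements are represented as data for programs. -/
class HasCode (α : Type) where
  /-- The representation of an element. -/
  code : α → Data

instance : HasCode Data := ⟨fun d => d⟩

instance : HasCode ℕ := ⟨Data.nat⟩

instance : HasCode Bool := ⟨fun b => .nat b.toNat⟩

instance {α β : Type} [HasCode α] [HasCode β] : HasCode (α × β) :=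
  ⟨fun p => .pair (HasCode.code p.1) (HasCode.code p.2)⟩

instance {α : Type} [HasCode α] : HasCode (List α) :=
  ⟨fun l => Data.ofList (l.map HasCode.code)⟩

/-- Bit length of the representation of `a`. -/
def codeLen {α : Type} [HasCode α] (a : α) : ℕ := (HasCode.code a).size

open HasCode (code)

section Len

variable {α β : Type} [HasCode α] [HasCode β]

theorem code_cons (a : α) (l : List α) : code (a :: l) = .pair (code a) (code l) := rfl

theorem codeLen_pair (a : α) (b : β) : codeLen (a, b) = codeLen a + codeLen b + 1 := rfl

theorem codeLen_nat (k : ℕ) : codeLen k = k.size + 1 := rfl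

theorem codeLen_nil : codeLen ([] : List α) = 1 := rfl

theorem codeLen_cons (a : α) (l : List α) : codeLen (a :: l) = codeLen a + codeLen l + 1 := rfl

theorem Data.one_le_size (d : Data) : 1 ≤ d.size := by
  cases d <;> simp [Data.size]

theorem one_le_codeLen (a : α) : 1 ≤ codeLen a := Data.one_le_size _

theorem codeLen_list (l : List α) : codeLen l = (l.map fun a => codeLen a + 1).sum + 1 := by
  induction l with
  | nil => rfl
  | cons a l ih => rw [codeLen_cons, ih, List.map_cons, List.sum_cons]; ring

theorem codeLen_append (l m : List α) : codeLen (l ++ m) + 1 = codeLen l + codeLen m := by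
  simp only [codeLen_list, List.map_append, List.sum_append]; omega

theorem codeLen_perm {l m : List α} (h : l.Perm m) : codeLen l = codeLen m := by
  rw [codeLen_list, codeLen_list, (h.map _).sum_eq]

theorem codeLen_sublist {l m : List α} (h : l.Sublist m) : codeLen l ≤ codeLen m := by
  rw [codeLen_list, codeLen_list]
  exact Nat.succ_le_succ ((h.map _).sum_le_sum (by simp))

theorem codeLen_mem {a : α} {l : List α} (h : a ∈ l) : codeLen a < codeLen l := by
  rw [codeLen_list]
  have := List.single_le_sum (l := l.map fun a => codeLen a + 1) (by simp) _
    (List.mem_map_of_mem h)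
  omega

theorem length_lt_codeLen (l : List α) : l.length < codeLen l := by
  induction l with
  | nil => simp [codeLen_nil]
  | cons a l ih => rw [codeLen_cons, List.length_cons]; omega

theorem codeLen_le_of_forall {l : List α} {n B : ℕ} (hn : l.length ≤ n)
    (h : ∀ a ∈ l, codeLen a ≤ B) :
    codeLen l ≤ n * (B + 1) + 1 := by
  rw [codeLen_list]
  have := List.sum_le_card_nsmul (l.map fun a => codeLen a + 1) (B + 1) (by
    intro x hx
    obtain ⟨a, ha, rfl⟩ := List.mem_map.1 hx
    exact Nat.succ_le_succ (h a ha))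
  rw [List.length_map, smul_eq_mul] at this
  exact Nat.succ_le_succ (this.trans (Nat.mul_le_mul_right _ hn))

end Len

theorem monotone_eval_nat (q : Polynomial ℕ) : Monotone fun n => q.eval n := by
  intro a b hab
  induction q using Polynomial.induction_on' with
  | add p q hp hq => simpa using Nat.add_le_add hp hq
  | monomial n c => simpa using Nat.mul_le_mul_left c (Nat.pow_le_pow_left hab n)

section PolyBound

variable {α β : Type} [HasCode α] [HasCode β]

/-- `g` is bounded by a polynomial in the bit length of its argument. -/
@[fun_prop]
def PolyBound (g : α → ℕ) : Prop := ∃ q : Polynomial ℕ, ∀ a, g a ≤ q.eval (codeLen a)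

theorem PolyBound.mono {g h : α → ℕ} (hh : PolyBound h) (hle : ∀ a, g a ≤ h a) : PolyBound g := by
  obtain ⟨q, hq⟩ := hh
  exact ⟨q, fun a => (hle a).trans (hq a)⟩

@[fun_prop]
theorem PolyBound.const (c : ℕ) : PolyBound fun _ : α => c :=
  ⟨Polynomial.C c, fun a => by simp⟩

theorem PolyBound.len_self : PolyBound fun a : α => codeLen a :=
  ⟨Polynomial.X, fun a => by simp⟩

@[fun_prop]
theorem PolyBound.add {g h : α → ℕ} (hg : PolyBound g) (hh : PolyBound h) :
    PolyBound fun a => g a + h a := by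
  obtain ⟨p, hp⟩ := hg
  obtain ⟨q, hq⟩ := hh
  exact ⟨p + q, fun a => by simpa using Nat.add_le_add (hp a) (hq a)⟩

@[fun_prop]
theorem PolyBound.mul {g h : α → ℕ} (hg : PolyBound g) (hh : PolyBound h) :
    PolyBound fun a => g a * h a := by
  obtain ⟨p, hp⟩ := hg
  obtain ⟨q, hq⟩ := hh
  exact ⟨p * q, fun a => by simpa using Nat.mul_le_mul (hp a) (hq a)⟩

/-- `f` is computed by a program whose running time is bounded by a polynomial in the bit length
of the argument. -/
@[fun_prop]
def PolyTime (f : α → β) : Prop :=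
  ∃ P : Program, ∃ T : α → ℕ, PolyBound T ∧ ∀ a, ∃ t ≤ T a, P.Runs (code a) (code (f a)) t

end PolyBound

theorem natSize_add_le (a b : ℕ) : (a + b).size ≤ a.size + b.size + 1 := by
  rw [Nat.size_le]
  have ha : a < 2 ^ (a.size + b.size) :=
    a.lt_size_self.trans_le (Nat.pow_le_pow_right (by norm_num) (by omega))
  have hb : b < 2 ^ (a.size + b.size) :=
    b.lt_size_self.trans_le (Nat.pow_le_pow_right (by norm_num) (by omega))
  rw [pow_succ]; omega

theorem natSize_mul_le (a b : ℕ) : (a * b).size ≤ a.size + b.size := by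
  rw [Nat.size_le, pow_add]
  exact Nat.mul_lt_mul'' a.lt_size_self b.lt_size_self

theorem Op.size_eval_le (o : Op) : ∃ c, ∀ x, (o.eval x).size ≤ x.size + c := by
  cases o with
  | const k => exact ⟨k.size + 1, fun x => by simp only [Op.eval, Data.size]; omega⟩
  | id => exact ⟨0, fun x => by simp [Op.eval]⟩
  | fst =>
    refine ⟨1, fun x => ?_⟩
    rcases x with _ | ⟨a, b⟩ <;> simp only [Op.eval, Data.size, Nat.size_zero] <;> omega
  | snd =>
    refine ⟨1, fun x => ?_⟩
    rcases x with _ | ⟨a, b⟩ <;> simp only [Op.eval, Data.size, Nat.size_zero] <;> omega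
  | isPair =>
    refine ⟨2, fun x => ?_⟩
    rcases x with _ | ⟨a, b⟩ <;> simp [Op.eval, Data.size]
  | le =>
    refine ⟨2, fun x => ?_⟩
    rcases x with _ | ⟨⟨a⟩ | _, ⟨b⟩ | _⟩ <;> simp [Op.eval, Data.size]
    split_ifs <;> simp
  | add =>
    refine ⟨2, fun x => ?_⟩
    rcases x with _ | ⟨⟨a⟩ | _, ⟨b⟩ | _⟩ <;> simp [Op.eval, Data.size]
    have := natSize_add_le a b
    omega
  | sub =>
    refine ⟨2, fun x => ?_⟩
    rcases x with _ | ⟨⟨a⟩ | _, ⟨b⟩ | _⟩ <;> simp [Op.eval, Data.size]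
    have : (a - b).size ≤ a.size := Nat.size_le_size (Nat.sub_le _ _)
    omega
  | mul =>
    refine ⟨2, fun x => ?_⟩
    rcases x with _ | ⟨⟨a⟩ | _, ⟨b⟩ | _⟩ <;> simp [Op.eval, Data.size]
    have := natSize_mul_le a b
    omega
  | div =>
    refine ⟨2, fun x => ?_⟩
    rcases x with _ | ⟨⟨a⟩ | _, ⟨b⟩ | _⟩ <;> simp [Op.eval, Data.size]
    have : (a / b).size ≤ a.size := Nat.size_le_size (Nat.div_le_self _ _)
    omega

/-- Results are at most linearly longer than the cost of the run that produces them. -/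
theorem Program.Runs.size_le (P : Program) :
    ∃ c, ∀ x y t, P.Runs x y t → y.size ≤ c * t := by
  induction P with
  | op o =>
    obtain ⟨c, hc⟩ := o.size_eval_le
    refine ⟨c + 1, fun x y t h => ?_⟩
    cases h
    have := hc x
    have := x.one_le_size
    nlinarith
  | seq f g _ hg =>
    obtain ⟨c, hc⟩ := hg
    refine ⟨c, fun x y t h => ?_⟩
    cases h with
    | seq h₁ h₂ => exact (hc _ _ _ h₂).trans (Nat.mul_le_mul_left _ (by omega))
  | fork f g hf hg =>
    obtain ⟨c, hc⟩ := hf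
    obtain ⟨d, hd⟩ := hg
    refine ⟨c + d + 1, fun x y t h => ?_⟩
    cases h with
    | fork h₁ h₂ =>
      have := hc _ _ _ h₁
      have := hd _ _ _ h₂
      have := x.one_le_size
      simp only [Data.size]
      nlinarith
  | cond b f g _ hf hg =>
    obtain ⟨c, hc⟩ := hf
    obtain ⟨d, hd⟩ := hg
    refine ⟨c + d, fun x y t h => ?_⟩
    cases h with
    | cond_true _ _ h => exact (hc _ _ _ h).trans (Nat.mul_le_mul (by omega) (by omega))
    | cond_false _ h => exact (hd _ _ _ h).trans (Nat.mul_le_mul (by omega) (by omega))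
  | loop b f _ _ =>
    refine ⟨1, fun x y t h => ?_⟩
    generalize hP : Program.loop b f = P at h
    induction h with
    | loop_stop => omega
    | loop_step _ _ _ _ _ _ ih => have := ih hP; omega
    | _ => cases hP

namespace PolyBound

variable {α β : Type} [HasCode α] [HasCode β]

theorem eval {g : α → ℕ} (hg : PolyBound g) (q : Polynomial ℕ) :
    PolyBound fun a => q.eval (g a) := by
  obtain ⟨b, hb⟩ := hg
  exact ⟨q.comp b, fun a => by rw [Polynomial.eval_comp]; exact monotone_eval_nat q (hb a)⟩

theorem comp {g : β → ℕ} {T : α → ℕ} {f : α → β} (hg : PolyBound g) (hT : PolyBound T)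
    (h : ∀ a, codeLen (f a) ≤ T a) : PolyBound fun a => g (f a) := by
  obtain ⟨p, hp⟩ := hg
  obtain ⟨q, hq⟩ := hT
  refine ⟨p.comp q, fun a => (hp _).trans ?_⟩
  rw [Polynomial.eval_comp]
  exact monotone_eval_nat p ((h a).trans (hq a))

end PolyBound

namespace PolyTime

variable {α β γ δ : Type} [HasCode α] [HasCode β] [HasCode γ] [HasCode δ]

/-- Results of polynomial-time functions are polynomially long. -/
@[fun_prop]
theorem len {f : α → β} (hf : PolyTime f) : PolyBound fun a => codeLen (f a) := by
  obtain ⟨P, T, hT, h⟩ := hf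
  obtain ⟨c, hc⟩ := Program.Runs.size_le P
  refine PolyBound.mono (h := fun a => c * T a) (by fun_prop) fun a => ?_
  obtain ⟨t, ht, hr⟩ := h a
  exact (hc _ _ _ hr).trans (Nat.mul_le_mul_left _ ht)

theorem congr {f g : α → β} (hf : PolyTime f) (h : ∀ a, f a = g a) : PolyTime g :=
  funext h ▸ hf

theorem of_op {f : α → β} (o : Op) (h : ∀ a, o.eval (code a) = code (f a)) : PolyTime f :=
  ⟨.op o, fun a => codeLen a, PolyBound.len_self, fun a =>
    ⟨_, le_rfl, by rw [← h]; exact .op o _⟩⟩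

/-- Reinterpreting an element of a type as an element of another type with the same code. -/
theorem of_code_eq {f : α → β} (h : ∀ a, code (f a) = code a) : PolyTime f :=
  of_op .id fun a => (h a).symm

@[fun_prop]
theorem id : PolyTime fun a : α => a := of_op .id fun _ => rfl

@[fun_prop]
theorem comp {g : β → γ} {f : α → β} (hg : PolyTime g) (hf : PolyTime f) :
    PolyTime fun a => g (f a) := by
  have hlen := hf.len
  obtain ⟨P, T, hT, hP⟩ := hf
  obtain ⟨Q, U, hU, hQ⟩ := hg
  have hU' : PolyBound fun a => U (f a) := hU.comp hlen fun _ => le_rfl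
  refine ⟨.seq P Q, fun a => codeLen a + T a + U (f a),
    (PolyBound.len_self.add hT).add hU', fun a => ?_⟩
  obtain ⟨s, hs, hr⟩ := hP a
  obtain ⟨t, ht, hr'⟩ := hQ (f a)
  exact ⟨_, by simp only [codeLen]; omega, .seq hr hr'⟩

@[fun_prop]
theorem prodMk {f : α → β} {g : α → γ} (hf : PolyTime f) (hg : PolyTime g) :
    PolyTime fun a => (f a, g a) := by
  obtain ⟨P, T, hT, hP⟩ := hf
  obtain ⟨Q, U, hU, hQ⟩ := hg
  refine ⟨.fork P Q, fun a => codeLen a + T a + U a,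
    (PolyBound.len_self.add hT).add hU, fun a => ?_⟩
  obtain ⟨s, hs, hr⟩ := hP a
  obtain ⟨t, ht, hr'⟩ := hQ a
  exact ⟨_, by simp only [codeLen]; omega, .fork hr hr'⟩

theorem _root_.PostedPrice.Program.exists_const (d : Data) :
    ∃ P : Program, ∃ c, ∀ x, ∃ t ≤ c * x.size, P.Runs x d t := by
  induction d with
  | nat k => exact ⟨.op (.const k), 1, fun x => ⟨_, by omega, .op (.const k) x⟩⟩
  | pair a b ha hb =>
    obtain ⟨P, c, hP⟩ := ha
    obtain ⟨Q, d, hQ⟩ := hb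
    refine ⟨.fork P Q, c + d + 1, fun x => ?_⟩
    obtain ⟨s, hs, hr⟩ := hP x
    obtain ⟨t, ht, hr'⟩ := hQ x
    exact ⟨_, by nlinarith, .fork hr hr'⟩

@[fun_prop]
theorem const (b : β) : PolyTime fun _ : α => b := by
  obtain ⟨P, c, hP⟩ := Program.exists_const (code b)
  exact ⟨P, fun a => c * codeLen a, (PolyBound.const c).mul PolyBound.len_self,
    fun a => hP (code a)⟩

@[fun_prop]
theorem fst : PolyTime fun p : α × β => p.1 := of_op .fst fun _ => rfl

@[fun_prop]
theorem snd : PolyTime fun p : α × β => p.2 := of_op .snd fun _ => rfl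

theorem of_op₂ {f g h : α → ℕ} (o : Op)
    (ho : ∀ a, o.eval (.pair (.nat (f a)) (.nat (g a))) = .nat (h a))
    (hf : PolyTime f) (hg : PolyTime g) : PolyTime h := by
  have h₁ : PolyTime fun x : Data => o.eval x := of_op o fun _ => rfl
  have h₂ : PolyTime fun a => (Data.pair (.nat (f a)) (.nat (g a))) := hf.prodMk hg
  obtain ⟨P, T, hT, hP⟩ := h₁.comp h₂
  exact ⟨P, T, hT, fun a => by have := hP a; simp only [ho] at this; exact this⟩

@[fun_prop]
theorem add {f g : α → ℕ} (hf : PolyTime f) (hg : PolyTime g) : PolyTime fun a => f a + g a :=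
  of_op₂ .add (fun _ => rfl) hf hg

@[fun_prop]
theorem sub {f g : α → ℕ} (hf : PolyTime f) (hg : PolyTime g) : PolyTime fun a => f a - g a :=
  of_op₂ .sub (fun _ => rfl) hf hg

@[fun_prop]
theorem mul {f g : α → ℕ} (hf : PolyTime f) (hg : PolyTime g) : PolyTime fun a => f a * g a :=
  of_op₂ .mul (fun _ => rfl) hf hg

@[fun_prop]
theorem div {f g : α → ℕ} (hf : PolyTime f) (hg : PolyTime g) : PolyTime fun a => f a / g a :=
  of_op₂ .div (fun _ => rfl) hf hg

@[fun_prop]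
theorem decide_le {f g : α → ℕ} (hf : PolyTime f) (hg : PolyTime g) :
    PolyTime fun a => decide (f a ≤ g a) := by
  have : PolyTime fun a => if f a ≤ g a then 1 else 0 := of_op₂ .le (fun _ => rfl) hf hg
  obtain ⟨P, T, hT, hP⟩ := this
  refine ⟨P, T, hT, fun a => ?_⟩
  convert hP a using 4
  by_cases h : f a ≤ g a <;> simp [h, code]

@[fun_prop]
theorem decide_lt {f g : α → ℕ} (hf : PolyTime f) (hg : PolyTime g) :
    PolyTime fun a => decide (f a < g a) := by
  have : PolyTime fun a => decide (f a + 1 ≤ g a) := by fun_prop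
  exact this

/-- Case distinction where each branch only has to be evaluated when it is taken. -/
theorem cond {p : α → Bool} {f g : α → β} (hp : PolyTime p) (hf : PolyTime f) (hg : PolyTime g) :
    PolyTime fun a => bif p a then f a else g a := by
  obtain ⟨C, R, hR, hC⟩ := hp
  obtain ⟨P, T, hT, hP⟩ := hf
  obtain ⟨Q, U, hU, hQ⟩ := hg
  refine ⟨.cond C P Q, fun a => codeLen a + R a + (T a + U a),
    (PolyBound.len_self.add hR).add (hT.add hU), fun a => ?_⟩
  obtain ⟨r, hr, hrun⟩ := hC a
  cases h : p a with
  | true =>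
    rw [h] at hrun
    obtain ⟨s, hs, hrun'⟩ := hP a
    refine ⟨_, ?_, .cond_true hrun (by simp [code]) (by beta_reduce; rw [h]; exact hrun')⟩
    simp only [codeLen]; omega
  | false =>
    rw [h] at hrun
    obtain ⟨s, hs, hrun'⟩ := hQ a
    refine ⟨_, ?_, .cond_false hrun (by beta_reduce; rw [h]; exact hrun')⟩
    simp only [codeLen]; omega

@[fun_prop]
theorem ite {p : α → Prop} [DecidablePred p] {f g : α → β} (hp : PolyTime fun a => decide (p a))
    (hf : PolyTime f) (hg : PolyTime g) : PolyTime fun a => if p a then f a else g a := by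
  convert cond hp hf hg using 2 with a
  by_cases h : p a <;> simp [h]

@[fun_prop]
theorem decide_and {p q : α → Prop} [DecidablePred p] [DecidablePred q]
    (hp : PolyTime fun a => decide (p a)) (hq : PolyTime fun a => decide (q a)) :
    PolyTime fun a => decide (p a ∧ q a) := by
  convert cond hp hq (const false) using 2 with a
  by_cases h : p a <;> simp [h]

@[fun_prop]
theorem decide_or {p q : α → Prop} [DecidablePred p] [DecidablePred q]
    (hp : PolyTime fun a => decide (p a)) (hq : PolyTime fun a => decide (q a)) :
    PolyTime fun a => decide (p a ∨ q a) := by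
  convert cond hp (const true) hq using 2 with a
  by_cases h : p a <;> simp [h]

@[fun_prop]
theorem decide_eq {f g : α → ℕ} (hf : PolyTime f) (hg : PolyTime g) :
    PolyTime fun a => decide (f a = g a) := by
  have : PolyTime fun a => decide (f a ≤ g a ∧ g a ≤ f a) := by fun_prop
  simpa only [← le_antisymm_iff] using this

@[fun_prop]
theorem cons {f : α → β} {l : α → List β} (hf : PolyTime f) (hl : PolyTime l) :
    PolyTime fun a => f a :: l a := by
  obtain ⟨P, T, hT, hP⟩ := hf.prodMk hl
  exact ⟨P, T, hT, hP⟩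

theorem listCases {l : α → List β} {f : α → γ} {g : α → β → List β → γ} (hl : PolyTime l)
    (hf : PolyTime f) (hg : PolyTime fun p : α × β × List β => g p.1 p.2.1 p.2.2) :
    PolyTime fun a => List.rec (motive := fun _ => γ) (f a) (fun b s _ => g a b s) (l a) := by
  obtain ⟨L, R, hR, hL⟩ := hl
  obtain ⟨P, T, hT, hP⟩ := hf
  obtain ⟨Q, U, hU, hQ⟩ := hg
  have hlen : PolyBound fun a => codeLen (l a) := len ⟨L, R, hR, hL⟩
  obtain ⟨u, hu⟩ := hU
  have hU' : PolyBound fun a => u.eval (codeLen a + codeLen (l a) + 1) :=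
    ((PolyBound.len_self.add hlen).add (.const 1)).eval u
  refine ⟨.cond (.seq L (.op .isPair)) (.seq (.fork (.op .id) L) Q) P,
    fun a => codeLen a * 5 + R a * 2 + codeLen (l a) * 2 + 1 + T a +
      u.eval (codeLen a + codeLen (l a) + 1),
    ((((((PolyBound.len_self.mul (.const 5)).add (hR.mul (.const 2))).add
      (hlen.mul (.const 2))).add (.const 1)).add hT).add hU'), fun a => ?_⟩
  obtain ⟨r, hr, hrun⟩ := hL a
  cases h : l a with
  | nil =>
    rw [h] at hrun
    obtain ⟨s, hs, hrun'⟩ := hP a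
    refine ⟨_, ?_, .cond_false (.seq hrun (.op .isPair _)) (by beta_reduce; rw [h]; exact hrun')⟩
    change codeLen a + (codeLen a + r + 1) + s ≤ _
    beta_reduce
    omega
  | cons b t =>
    rw [h] at hrun
    obtain ⟨s, hs, hrun'⟩ := hQ (a, b, t)
    refine ⟨_, ?_, .cond_true (.seq hrun (.op .isPair _)) (by simp [code_cons, Op.eval])
      (.seq (.fork (.op .id _) hrun) (by beta_reduce; rw [h]; exact hrun'))⟩
    have := hu (a, b, t)
    rw [codeLen_pair, codeLen_pair, ← codeLen_cons] at this
    change codeLen a + (codeLen a + r + codeLen (b :: t)) +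
      (codeLen a + (codeLen a + codeLen a + r) + s) ≤ _
    beta_reduce
    rw [h]
    omega

end PolyTime

/-- A loop that ends after `N` rounds, all of whose rounds cost at most `G`. -/
theorem Program.Runs.iterate {σ : Type} [HasCode σ] {C P : Program} {step : σ → σ}
    {test : σ → Bool} {G : ℕ} (N : ℕ) (s : σ)
    (hC : ∀ k ≤ N, ∃ t ≤ G, C.Runs (code (step^[k] s)) (code (test (step^[k] s))) t)
    (hP : ∀ k < N, ∃ t ≤ G, P.Runs (code (step^[k] s)) (code (step^[k + 1] s)) t)
    (hlen : ∀ k ≤ N, codeLen (step^[k] s) ≤ G)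
    (hrun : ∀ k < N, test (step^[k] s) = true) (hend : test (step^[N] s) = false) :
    ∃ t ≤ (N + 1) * (3 * G), (Program.loop C P).Runs (code s) (code (step^[N] s)) t := by
  induction N generalizing s with
  | zero =>
    obtain ⟨t, ht, hr⟩ := hC 0 le_rfl
    rw [hend] at hr
    have := hlen 0 le_rfl
    refine ⟨_, ?_, Program.Runs.loop_stop hr⟩
    simp only [codeLen, Function.iterate_zero, id_eq] at this ⊢
    omega
  | succ N ih =>
    obtain ⟨u, hu, hr⟩ := ih (step s)
      (fun k hk => hC (k + 1) (by omega)) (fun k hk => hP (k + 1) (by omega))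
      (fun k hk => hlen (k + 1) (by omega)) (fun k hk => hrun (k + 1) (by omega)) hend
    obtain ⟨t, ht, hr'⟩ := hC 0 (by omega)
    rw [hrun 0 (by omega)] at hr'
    obtain ⟨v, hv, hr''⟩ := hP 0 (by omega)
    have := hlen 0 (by omega)
    refine ⟨_, ?_, .loop_step hr' (by simp [code]) hr'' hr⟩
    simp only [codeLen, Function.iterate_zero, id_eq] at this ⊢
    have e : (N + 1 + 1) * (3 * G) = (N + 1) * (3 * G) + 3 * G := by ring
    omega

namespace PolyTime

variable {α β γ σ : Type} [HasCode α] [HasCode β] [HasCode γ] [HasCode σ]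

/-- A loop takes polynomial time if the number of rounds and the sizes of all intermediate states
are polynomially bounded. -/
theorem iterate {s : α → σ} {test : σ → Bool} {step : σ → σ} {N B : α → ℕ} (hs : PolyTime s)
    (htest : PolyTime test) (hstep : PolyTime step) (hN : PolyBound N) (hB : PolyBound B)
    (hlen : ∀ a, ∀ k ≤ N a, codeLen (step^[k] (s a)) ≤ B a)
    (hrun : ∀ a, ∀ k < N a, test (step^[k] (s a)) = true)
    (hend : ∀ a, test (step^[N a] (s a)) = false) :
    PolyTime fun a => step^[N a] (s a) := by
  obtain ⟨S, V, hV, hS⟩ := hs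
  obtain ⟨C, T, ⟨p, hp⟩, hC⟩ := htest
  obtain ⟨P, U, ⟨q, hq⟩, hP⟩ := hstep
  refine ⟨.seq S (.loop C P), fun a => codeLen a + V a +
    (N a + 1) * (3 * (p.eval (B a) + q.eval (B a) + B a)),
    (PolyBound.len_self.add hV).add ((hN.add (.const 1)).mul ((PolyBound.const 3).mul
      (((hB.eval p).add (hB.eval q)).add hB))), fun a => ?_⟩
  obtain ⟨t, ht, hr⟩ := Program.Runs.iterate (C := C) (P := P) (step := step) (test := test)
    (G := p.eval (B a) + q.eval (B a) + B a) (N a) (s a)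
    (fun k hk => by
      obtain ⟨t, ht, hr⟩ := hC (step^[k] (s a))
      have := (ht.trans (hp _)).trans (monotone_eval_nat p (hlen a k hk))
      exact ⟨t, by simp only at this; omega, hr⟩)
    (fun k hk => by
      obtain ⟨t, ht, hr⟩ := hP (step^[k] (s a))
      have := (ht.trans (hq _)).trans (monotone_eval_nat q (hlen a k hk.le))
      rw [Function.iterate_succ_apply']
      exact ⟨t, by simp only at this; omega, hr⟩)
    (fun k hk => (hlen a k hk).trans (by omega)) (hrun a) (hend a)
  obtain ⟨v, hv, hr'⟩ := hS a
  exact ⟨_, by simp only [codeLen]; omega, .seq hr' hr⟩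

/-- A left fold takes polynomial time if each step does and the results on all prefixes are
polynomially bounded. The step has access to the input of the whole computation. -/
theorem listWalk {b : α → σ} {l : α → List β} {st : α → β → σ → σ} {B : α → ℕ}
    (hb : PolyTime b) (hl : PolyTime l) (hst : PolyTime fun p : α × β × σ => st p.1 p.2.1 p.2.2)
    (hB : PolyBound B)
    (hlen : ∀ a m, m <+: l a → codeLen (m.foldl (fun x y => st a y x) (b a)) ≤ B a) :
    PolyTime fun a => (l a).foldl (fun x y => st a y x) (b a) := by
  let step : α × List β × σ → α × List β × σ := fun p =>
    List.rec (motive := fun _ => α × List β × σ) p (fun y s _ => (p.1, s, st p.1 y p.2.2)) p.2.1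
  let test : α × List β × σ → Bool := fun p =>
    List.rec (motive := fun _ => Bool) false (fun _ _ _ => true) p.2.1
  have hstep : PolyTime step := by
    refine listCases (l := fun p : α × List β × σ => p.2.1) (f := fun p => p)
      (g := fun p y s => (p.1, s, st p.1 y p.2.2)) (by fun_prop) (by fun_prop) ?_
    have : PolyTime fun p : (α × List β × σ) × β × List β => st p.1.1 p.2.1 p.1.2.2 :=
      hst.comp (f := fun p : (α × List β × σ) × β × List β => (p.1.1, p.2.1, p.1.2.2))
        (by fun_prop)
    fun_prop
  have htest : PolyTime test :=
    listCases (l := fun p : α × List β × σ => p.2.1) (f := fun p => false)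
      (g := fun p y s => true) (by fun_prop) (by fun_prop) (by fun_prop)
  have key : ∀ a, ∀ k ≤ (l a).length, step^[k] (a, l a, b a) =
      (a, (l a).drop k, ((l a).take k).foldl (fun x y => st a y x) (b a)) := by
    intro a k
    induction k with
    | zero => simp
    | succ k ih =>
      intro hk
      rw [Function.iterate_succ_apply', ih (by omega), List.drop_eq_getElem_cons (by omega),
        ← List.take_concat_get' _ _ (by omega : k < (l a).length), List.foldl_append]
      rfl
  have h₁ : PolyTime fun a => (a, l a, b a) := by fun_prop
  have main := iterate (step := step) (test := test) (N := fun a => (l a).length)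
    (B := fun a => codeLen a + (codeLen (l a) + B a + 1) + 1) h₁ htest hstep
    (hl.len.mono fun a => (length_lt_codeLen _).le)
    ((PolyBound.len_self.add ((hl.len.add hB).add (.const 1))).add (.const 1))
    (fun a k hk => by
      rw [key a k hk, codeLen_pair, codeLen_pair]
      have := hlen a _ (List.take_prefix k (l a))
      have := codeLen_sublist (List.drop_sublist k (l a))
      omega)
    (fun a k hk => by
      rw [key a k hk.le]
      simp only [test, List.drop_eq_getElem_cons hk])
    (fun a => by rw [key a _ le_rfl]; simp [test])
  have : PolyTime fun a => (step^[(l a).length] (a, l a, b a)).2.2 := by fun_prop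
  refine this.congr fun a => ?_
  rw [key a _ le_rfl, List.take_length]

@[fun_prop]
theorem reverse {l : α → List β} (hl : PolyTime l) : PolyTime fun a => (l a).reverse := by
  have := listWalk (b := fun _ : α => ([] : List β)) (l := l) (st := fun _ y s => y :: s)
    (B := fun a => codeLen (l a)) (by fun_prop) hl (by fun_prop) hl.len
    (fun a m hm => by
      rw [List.foldl_flip_cons_eq_append', List.append_nil, codeLen_perm m.reverse_perm]
      exact codeLen_sublist hm.sublist)
  refine this.congr fun a => ?_
  rw [List.foldl_flip_cons_eq_append', List.append_nil]

/-- Structural recursion on lists takes polynomial time if each step does and the results on all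
suffixes are polynomially bounded. It is run as a left fold over the reversed list, whose state
consists of the suffix treated so far and the result on it. -/
theorem listRec {F : α → List β → σ} {l : α → List β} (b : α → σ)
    (st : α → β → List β → σ → σ) {B : α → ℕ}
    (h₀ : ∀ a, F a [] = b a) (h₁ : ∀ a y s, F a (y :: s) = st a y s (F a s))
    (hb : PolyTime b) (hl : PolyTime l)
    (hst : PolyTime fun p : α × β × List β × σ => st p.1 p.2.1 p.2.2.1 p.2.2.2)
    (hB : PolyBound B) (hlen : ∀ a s, s <:+ l a → codeLen (F a s) ≤ B a) :
    PolyTime fun a => F a (l a) := by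
  have key : ∀ a (m s : List β), m.foldl (fun (x : List β × σ) y =>
      (y :: x.1, st a y x.1 x.2)) (s, F a s) = (m.reverse ++ s, F a (m.reverse ++ s)) := by
    intro a m
    induction m with
    | nil => intro s; rfl
    | cons y m ih => intro s; rw [List.foldl_cons, ← h₁, ih]; simp
  have hst' : PolyTime fun p : α × β × List β × σ =>
      (p.2.1 :: p.2.2.1, st p.1 p.2.1 p.2.2.1 p.2.2.2) := by fun_prop
  have hB' : PolyBound fun a => codeLen (l a) + B a + 1 := by fun_prop
  have := listWalk (b := fun a => (([] : List β), b a)) (l := fun a => (l a).reverse)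
    (st := fun a y (x : List β × σ) => (y :: x.1, st a y x.1 x.2)) (by fun_prop) (by fun_prop)
    hst' hB' (fun a m hm => by
      rw [← h₀, key, List.append_nil, codeLen_pair]
      have h := List.reverse_suffix.2 hm
      rw [List.reverse_reverse] at h
      have := hlen a _ h
      have := codeLen_sublist h.sublist
      omega)
  have : PolyTime fun a => ((l a).reverse.foldl (fun (x : List β × σ) y =>
      (y :: x.1, st a y x.1 x.2)) (([] : List β), b a)).2 := by fun_prop
  refine this.congr fun a => ?_
  rw [← h₀, key]; simp

end PolyTime

/-! ### List functions in polynomial time -/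

theorem codeLen_sum_le (l : List ℕ) : codeLen l.sum ≤ codeLen l := by
  induction l with
  | nil => simp [codeLen_nat, codeLen_nil]
  | cons a l ih =>
    have := natSize_add_le a l.sum
    rw [List.sum_cons, codeLen_cons, codeLen_nat, codeLen_nat]
    rw [codeLen_nat] at ih
    omega

theorem codeLen_prod_le (l : List ℕ) : codeLen l.prod ≤ codeLen l + 1 := by
  induction l with
  | nil => simp [codeLen_nat, codeLen_nil]
  | cons a l ih =>
    have := natSize_mul_le a l.prod
    rw [List.prod_cons, codeLen_cons, codeLen_nat, codeLen_nat]
    rw [codeLen_nat] at ih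
    omega

theorem codeLen_flatten_le {α : Type} [HasCode α] (l : List (List α)) :
    codeLen l.flatten ≤ codeLen l := by
  induction l with
  | nil => rfl
  | cons a l ih =>
    have := codeLen_append a l.flatten
    rw [List.flatten_cons, codeLen_cons]
    omega

theorem foldr_choose_mem {β : Type} (p : β → β → Bool) (l : List β) (d : β) :
    l.foldr (fun y r => bif p y r then y else r) d ∈ d :: l := by
  induction l with
  | nil => simp
  | cons y s ih =>
    rw [List.foldr_cons]
    cases p y (List.foldr (fun y r => bif p y r then y else r) d s)
    · rcases List.mem_cons.1 ih with h | h
      · rw [h]; simp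
      · simp only [cond_false, List.mem_cons, h, or_true]
    · simp

namespace PolyTime

variable {α β γ : Type} [HasCode α] [HasCode β] [HasCode γ]

@[fun_prop]
theorem append {l m : α → List β} (hl : PolyTime l) (hm : PolyTime m) :
    PolyTime fun a => l a ++ m a := by
  refine listRec (F := fun a (s : List β) => s ++ m a) (B := fun a => codeLen (l a) +
    codeLen (m a)) m (fun _ y _ r => y :: r) (fun _ => rfl) (fun _ _ _ => rfl)
    hm hl (by fun_prop) (by fun_prop) fun a s hs => ?_
  have := codeLen_append s (m a)
  have := codeLen_sublist hs.sublist
  omega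

theorem map {f : α → β → γ} {l : α → List β} (hf : PolyTime fun p : α × β => f p.1 p.2)
    (hl : PolyTime l) : PolyTime fun a => (l a).map (f a) := by
  obtain ⟨q, hq⟩ := hf.len
  refine listRec (F := fun a (s : List β) => s.map (f a)) (B := fun a => codeLen (l a) *
    (q.eval (codeLen a + codeLen (l a) + 1) + 1) + 1) (fun _ => [])
    (fun a y _ r => f a y :: r) (fun _ => rfl) (fun _ _ _ => rfl) (by fun_prop) hl ?_ ?_
    fun a s hs => ?_
  · have : PolyTime fun p : α × β × List β × List γ => f p.1 p.2.1 :=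
      hf.comp (f := fun p : α × β × List β × List γ => (p.1, p.2.1)) (by fun_prop)
    fun_prop
  · exact ((hl.len.mul ((((PolyBound.len_self.add hl.len).add (.const 1)).eval q).add
      (.const 1))).add (.const 1))
  · refine codeLen_le_of_forall ?_ fun c hc => ?_
    · rw [List.length_map]
      exact hs.length_le.trans (length_lt_codeLen _).le
    · obtain ⟨y, hy, rfl⟩ := List.mem_map.1 hc
      refine (hq (a, y)).trans (monotone_eval_nat q ?_)
      have := codeLen_mem (hs.subset hy)
      rw [codeLen_pair]
      omega

theorem filter {p : α → β → Bool} {l : α → List β} (hp : PolyTime fun x : α × β => p x.1 x.2)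
    (hl : PolyTime l) : PolyTime fun a => (l a).filter (p a) := by
  refine listRec (F := fun a (s : List β) => s.filter (p a)) (B := fun a => codeLen (l a))
    (fun _ => []) (fun a y _ r => bif p a y then y :: r else r) (fun _ => rfl)
    (fun a y s => by cases h : p a y <;> simp [h]) (by fun_prop) hl ?_ (by fun_prop)
    fun a s hs => codeLen_sublist (List.filter_sublist.trans hs.sublist)
  refine cond (hp.comp (f := fun x : α × β × List β × List β => (x.1, x.2.1)) ?_) ?_ ?_ <;>
    fun_prop

@[fun_prop]
theorem flatten {l : α → List (List β)} (hl : PolyTime l) : PolyTime fun a => (l a).flatten := by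
  refine listRec (F := fun _ (s : List (List β)) => s.flatten)
    (B := fun a => codeLen (l a)) (fun _ => []) (fun _ y _ r => y ++ r) (fun _ => rfl)
    (fun _ _ _ => rfl) (by fun_prop) hl (by fun_prop) (by fun_prop)
    fun a s hs => (codeLen_flatten_le s).trans (codeLen_sublist hs.sublist)

@[fun_prop]
theorem sum {l : α → List ℕ} (hl : PolyTime l) : PolyTime fun a => (l a).sum := by
  refine listRec (F := fun _ (s : List ℕ) => s.sum) (B := fun a => codeLen (l a))
    (fun _ => 0) (fun _ y _ r => y + r) (fun _ => rfl) (fun _ _ _ => List.sum_cons) (by fun_prop)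
    hl (by fun_prop) (by fun_prop)
    fun a s hs => (codeLen_sum_le s).trans (codeLen_sublist hs.sublist)

@[fun_prop]
theorem prod {l : α → List ℕ} (hl : PolyTime l) : PolyTime fun a => (l a).prod := by
  refine listRec (F := fun _ (s : List ℕ) => s.prod) (B := fun a => codeLen (l a) + 1)
    (fun _ => 1) (fun _ y _ r => y * r) (fun _ => rfl) (fun _ _ _ => List.prod_cons) (by fun_prop)
    hl (by fun_prop) (by fun_prop)
    fun a s hs => (codeLen_prod_le s).trans (Nat.succ_le_succ (codeLen_sublist hs.sublist))

@[fun_prop]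
theorem isEmpty {l : α → List β} (hl : PolyTime l) : PolyTime fun a => (l a).isEmpty :=
  (listCases (g := fun _ _ _ => false) hl (const true) (by fun_prop)).congr fun a => by
    cases l a <;> rfl

@[fun_prop]
theorem headD {l : α → List β} {d : α → β} (hl : PolyTime l) (hd : PolyTime d) :
    PolyTime fun a => (l a).headD (d a) :=
  (listCases (g := fun _ y _ => y) hl hd (by fun_prop)).congr fun a => by cases l a <;> rfl

/-- Running choice of the better of two list elements. -/
theorem foldr_choose {p : α → β → β → Bool} {l : α → List β} {d : α → β}
    (hp : PolyTime fun x : α × β × β => p x.1 x.2.1 x.2.2) (hl : PolyTime l) (hd : PolyTime d) :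
    PolyTime fun a => (l a).foldr (fun y r => bif p a y r then y else r) (d a) := by
  refine listRec (F := fun a (s : List β) => s.foldr (fun y r => bif p a y r then y else r) (d a))
    (B := fun a => codeLen (l a) + codeLen (d a)) d
    (fun a y _ r => bif p a y r then y else r) (fun _ => rfl) (fun _ _ _ => rfl) hd
    hl ?_ (by fun_prop) fun a s hs => ?_
  · refine cond (hp.comp (f := fun x : α × β × List β × β => (x.1, x.2.1, x.2.2.2)) ?_) ?_ ?_ <;>
      fun_prop
  · rcases List.mem_cons.1 (foldr_choose_mem (p a) s (d a)) with h | h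
    · rw [h]; omega
    · have := codeLen_mem (hs.subset h); omega

@[fun_prop]
theorem decide_eq_true {p : α → Bool} (hp : PolyTime p) : PolyTime fun a => decide (p a = true) :=
  hp.congr fun a => by simp

theorem orderedInsert {r : β → β → Prop} [DecidableRel r] {x : α → β} {l : α → List β}
    (hr : PolyTime fun p : β × β => decide (r p.1 p.2)) (hx : PolyTime x) (hl : PolyTime l) :
    PolyTime fun a => (l a).orderedInsert r (x a) := by
  refine listRec (F := fun a (s : List β) => s.orderedInsert r (x a))
    (B := fun a => codeLen (x a) + codeLen (l a) + 1) (fun a => [x a])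
    (fun a y s t => if r (x a) y then x a :: y :: s else y :: t) (fun _ => rfl)
    (fun _ _ _ => rfl) (by fun_prop) hl ?_ (by fun_prop) fun a s hs => ?_
  · have : PolyTime fun p : α × β × List β × List β => decide (r (x p.1) p.2.1) :=
      hr.comp (f := fun p : α × β × List β × List β => (x p.1, p.2.1)) (by fun_prop)
    fun_prop
  · rw [codeLen_perm (List.perm_orderedInsert r (x a) s), codeLen_cons]
    have := codeLen_sublist hs.sublist
    omega

theorem insertionSort {r : β → β → Prop} [DecidableRel r] {l : α → List β}
    (hr : PolyTime fun p : β × β => decide (r p.1 p.2)) (hl : PolyTime l) :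
    PolyTime fun a => (l a).insertionSort r := by
  refine listRec (F := fun _ (s : List β) => s.insertionSort r)
    (B := fun a => codeLen (l a)) (fun _ => [])
    (fun _ y _ t => t.orderedInsert r y) (fun _ => rfl)
    (fun _ _ _ => rfl) (by fun_prop) hl (orderedInsert hr (by fun_prop) (by fun_prop))
    (by fun_prop) fun a s hs => ?_
  rw [codeLen_perm (List.perm_insertionSort r s)]
  exact codeLen_sublist hs.sublist

/-- Repeating a step once for every element of a list. -/
theorem iterate_length {step : α → β → β} {s : α → β} {l : α → List γ} {B : α → ℕ}
    (hstep : PolyTime fun p : α × β => step p.1 p.2) (hs : PolyTime s) (hl : PolyTime l)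
    (hB : PolyBound B) (hlen : ∀ a k, codeLen ((step a)^[k] (s a)) ≤ B a) :
    PolyTime fun a => (step a)^[(l a).length] (s a) := by
  refine listRec (F := fun a (m : List γ) => (step a)^[m.length] (s a)) (B := B) s
    (fun a _ _ r => step a r) (fun _ => rfl)
    (fun a y m => by rw [List.length_cons, Function.iterate_succ_apply']) hs hl ?_ hB
    fun a m _ => hlen a _
  exact hstep.comp (f := fun p : α × γ × List γ × β => (p.1, p.2.2.2)) (by fun_prop)

@[fun_prop]
theorem length {l : α → List β} (hl : PolyTime l) : PolyTime fun a => (l a).length := by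
  refine ((map (f := fun _ _ => 1) (by fun_prop) hl).sum).congr fun a => by simp

theorem zipIdx {l : α → List β} (hl : PolyTime l) : PolyTime fun a => (l a).zipIdx := by
  -- Recursion on suffixes numbers an element by the length of the rest of the list.
  let F : α → List β → List (β × ℕ) := fun a s =>
    List.rec (motive := fun _ => List (β × ℕ)) []
      (fun y m r => (y, (l a).length - (m.length + 1)) :: r) s
  have hF : ∀ a s, s.length ≤ (l a).length → F a s = s.zipIdx ((l a).length - s.length) := by
    intro a s
    induction s with
    | nil => intro _; rfl
    | cons y s ih =>
      intro h
      rw [List.length_cons] at h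
      rw [List.zipIdx_cons, List.length_cons,
        show (l a).length - (s.length + 1) + 1 = (l a).length - s.length by omega,
        ← ih (by omega)]
  refine (listRec (F := F) (B := fun a => codeLen (l a) *
      ((2 * codeLen (l a) + 2) + 1) + 1) (fun _ => [])
    (fun a y m r => (y, (l a).length - (m.length + 1)) :: r) (fun _ => rfl)
    (fun _ _ _ => rfl) (by fun_prop) hl ?_ (by fun_prop) ?_).congr
    fun a => by rw [hF a _ le_rfl, Nat.sub_self]
  · have : PolyTime fun p : α × β × List β × List (β × ℕ) => l p.1 := hl.comp (by fun_prop)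
    fun_prop
  · intro a s hs
    rw [hF a s hs.length_le]
    refine codeLen_le_of_forall ?_ fun c hc => ?_
    · rw [List.length_zipIdx]
      exact hs.length_le.trans (length_lt_codeLen _).le
    · obtain ⟨y, i⟩ := c
      obtain ⟨-, hi, -⟩ := List.mem_zipIdx hc
      have h₁ := codeLen_mem (hs.subset (List.fst_mem_of_mem_zipIdx hc))
      have h₂ := length_lt_codeLen (l a)
      have h₃ := hs.length_le
      have h₄ : i.size ≤ i := Nat.size_le.2 i.lt_two_pow_self
      simp only at h₁
      rw [codeLen_pair, codeLen_nat]
      omega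

end PolyTime

/-! ### The algorithm -/

/-- An offer under consideration. The computations use multiples by a common denominator of the
price and of the probability of acceptance; the price itself is kept for the output. -/
structure Offer where
  /-- The buyer. -/
  buyer : ℕ
  /-- The price as numerator and denominator. -/
  price : ℕ × ℕ
  /-- The scaled price. -/
  cost : ℕ
  /-- The scaled probability of acceptance. -/
  mass : ℕ

instance : HasCode Offer := ⟨fun o => code (o.buyer, o.price, o.cost, o.mass)⟩

instance : Inhabited Offer := ⟨⟨0, (0, 1), 0, 0⟩⟩

/-- A buyer's current offer and all offers that may be made to this buyer. -/
abbrev Slot : Type := Offer × List Offer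

/-- A value and its probability, each as numerator and denominator. -/
abbrev Entry : Type := (ℕ × ℕ) × (ℕ × ℕ)

/-- A common denominator of all numbers in the input. -/
def commonDen (B : List (List Entry)) : ℕ :=
  (B.map fun l => (l.map fun e => e.1.2 * e.2.2).prod).prod

/-- The multiple by `D` of the fraction `r`. -/
def scaled (D : ℕ) (r : ℕ × ℕ) : ℕ := r.1 * (D / r.2)

/-- The scaled probability of a value of at least that of `e`. -/
def tailMass (D : ℕ) (l : List Entry) (e : Entry) : ℕ :=
  ((l.filter fun e' => decide (scaled D e.1 ≤ scaled D e'.1)).map fun e' => scaled D e'.2).sum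

/-- The offer of the value of `e` to buyer `i` with distribution `l`. -/
def entryOffer (D : ℕ) (l : List Entry) (i : ℕ) (e : Entry) : Offer :=
  ⟨i, e.1, scaled D e.1, tailMass D l e⟩

/-- The offer that stands for not serving buyer `i`. -/
def nullOffer (i : ℕ) : Offer := ⟨i, (0, 1), 0, 0⟩

/-- Nobody is served. -/
def initialSlots (B : List (List Entry)) : List Slot :=
  B.zipIdx.map fun x => (nullOffer x.2, x.1.map (entryOffer (commonDen B) x.1 x.2))

/-- The scaled expected number of acceptances. -/
def slotsMass (s : List Slot) : ℕ := (s.map fun x => x.1.mass).sum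

/-- The pairs of a current offer and a replacement with larger mass and larger revenue. -/
def upgrades (s : List Slot) : List (Offer × Offer) :=
  (s.map fun x => (x.2.filter fun o => decide (x.1.mass < o.mass ∧
    x.1.cost * x.1.mass < o.cost * o.mass)).map fun o => (x.1, o)).flatten

/-- The upgrade `u` gains at least as much revenue per unit of mass as the upgrade `w`. -/
def steeper (u w : Offer × Offer) : Bool :=
  decide ((w.2.cost * w.2.mass - w.1.cost * w.1.mass) * (u.2.mass - u.1.mass) ≤
    (u.2.cost * u.2.mass - u.1.cost * u.1.mass) * (w.2.mass - w.1.mass))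

/-- The upgrade with the largest revenue gain per unit of mass. -/
def steepest (us : List (Offer × Offer)) : Offer × Offer :=
  us.foldr (fun u w => bif steeper u w then u else w) (us.headD default)

/-- Replacing the current offer to the buyer of `o` by `o`. -/
def switchTo (s : List Slot) (o : Offer) : List Slot :=
  s.map fun x => if x.1.buyer = o.buyer then (o, x.2) else x

/-- One step of the greedy algorithm on pairs of a previous and a current state. Nothing changes
once the capacity is exceeded or no upgrade is left. -/
def ascend (K D : ℕ) (p : List Slot × List Slot) : List Slot × List Slot :=
  if K * D < slotsMass p.2 ∨ (upgrades p.2).isEmpty = true then p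
  else (p.2, switchTo p.2 (steepest (upgrades p.2)).2)

/-- The last two states of the greedy algorithm. -/
def finalStates (K : ℕ) (B : List (List Entry)) : List Slot × List Slot :=
  (ascend K (commonDen B))^[B.flatten.length] (initialSlots B, initialSlots B)

/-- The current offers by decreasing price. -/
def sortedOffers (s : List Slot) : List Offer :=
  (s.map fun x => x.1).insertionSort fun o o' => o'.cost ≤ o.cost

/-- Expected revenues with one more offer, for all numbers of copies in decreasing order, from
those without it. -/
def revenueRow (D S : ℕ) (o : Offer) : List ℕ → List ℕ
  | [] => []
  | x :: l => (o.mass * (o.cost * S + l.headD 0) + (D - o.mass) * x) :: revenueRow D S o l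

/-- A power of `D` and the scaled expected revenues of a list of offers for `k, k - 1, …, 1`
copies, where `k` is the length of `z`. -/
def revenueTable (D : ℕ) (z : List ℕ) (l : List Offer) : ℕ × List ℕ :=
  l.foldr (fun o r => (D * r.1, revenueRow D r.1 o r.2)) (1, z)

/-- The scaled expected revenue of the current offers for `K` copies. -/
def scaledRevenue (K D : ℕ) (s : List Slot) : ℕ :=
  (revenueTable D (List.replicate (min K s.length) 0) (sortedOffers s)).2.headD 0

/-- The offers in the form of the output. -/
def outputOffers (s : List Slot) : List (ℕ × (ℕ × ℕ)) :=
  (sortedOffers s).map fun o => (o.buyer, o.price)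

/-- The whole algorithm: the better one of the last two states of the greedy algorithm. -/
def bestOffers (x : ℕ × List (List Entry)) : List (ℕ × (ℕ × ℕ)) :=
  if scaledRevenue x.1 (commonDen x.2) (finalStates x.1 x.2).1 ≤
      scaledRevenue x.1 (commonDen x.2) (finalStates x.1 x.2).2
  then outputOffers (finalStates x.1 x.2).2 else outputOffers (finalStates x.1 x.2).1

theorem length_revenueRow (D S : ℕ) (o : Offer) (l : List ℕ) :
    (revenueRow D S o l).length = l.length := by
  induction l with
  | nil => rfl
  | cons y m ih => rw [revenueRow, List.length_cons, ih, List.length_cons]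

/-! ### The algorithm takes polynomial time -/

namespace PolyTime

variable {α : Type} [HasCode α]

theorem offer_toProd : PolyTime fun o : Offer => (o.buyer, o.price, o.cost, o.mass) :=
  of_code_eq fun _ => rfl

theorem offer_ofProd :
    PolyTime fun x : ℕ × (ℕ × ℕ) × ℕ × ℕ => Offer.mk x.1 x.2.1 x.2.2.1 x.2.2.2 :=
  of_code_eq fun _ => rfl

@[fun_prop]
theorem buyer {f : α → Offer} (hf : PolyTime f) : PolyTime fun a => (f a).buyer :=
  fst.comp (offer_toProd.comp hf)

@[fun_prop]
theorem price {f : α → Offer} (hf : PolyTime f) : PolyTime fun a => (f a).price :=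
  fst.comp (snd.comp (offer_toProd.comp hf))

@[fun_prop]
theorem cost {f : α → Offer} (hf : PolyTime f) : PolyTime fun a => (f a).cost :=
  fst.comp (snd.comp (snd.comp (offer_toProd.comp hf)))

@[fun_prop]
theorem mass {f : α → Offer} (hf : PolyTime f) : PolyTime fun a => (f a).mass :=
  snd.comp (snd.comp (snd.comp (offer_toProd.comp hf)))

@[fun_prop]
theorem offerMk {f : α → ℕ} {g : α → ℕ × ℕ} {h k : α → ℕ} (hf : PolyTime f) (hg : PolyTime g)
    (hh : PolyTime h) (hk : PolyTime k) : PolyTime fun a => Offer.mk (f a) (g a) (h a) (k a) :=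
  offer_ofProd.comp (hf.prodMk (hg.prodMk (hh.prodMk hk)))

@[fun_prop]
theorem commonDen : PolyTime PostedPrice.commonDen := by
  refine (map (f := fun _ (l : List Entry) => (l.map fun e => e.1.2 * e.2.2).prod)
    (l := fun B : List (List Entry) => B) (prod ?_) id).prod
  exact map (f := fun _ (e : Entry) => e.1.2 * e.2.2) (by fun_prop) snd

@[fun_prop]
theorem scaled {f : α → ℕ} {g : α → ℕ × ℕ} (hf : PolyTime f) (hg : PolyTime g) :
    PolyTime fun a => PostedPrice.scaled (f a) (g a) := by
  unfold PostedPrice.scaled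
  fun_prop

@[fun_prop]
theorem entryOffer {D : α → ℕ} {l : α → List Entry} {i : α → ℕ} {e : α → Entry} (hD : PolyTime D)
    (hl : PolyTime l) (hi : PolyTime i) (he : PolyTime e) :
    PolyTime fun a => PostedPrice.entryOffer (D a) (l a) (i a) (e a) := by
  have : PolyTime fun a => tailMass (D a) (l a) (e a) := by
    refine (map (f := fun a (e' : Entry) => PostedPrice.scaled (D a) e'.2)
      (l := fun a => (l a).filter fun e' =>
        decide (PostedPrice.scaled (D a) (e a).1 ≤ PostedPrice.scaled (D a) e'.1))
      (by fun_prop) ?_).sum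
    exact filter (p := fun a (e' : Entry) =>
      decide (PostedPrice.scaled (D a) (e a).1 ≤ PostedPrice.scaled (D a) e'.1)) (by fun_prop) hl
  unfold PostedPrice.entryOffer
  fun_prop

@[fun_prop]
theorem initialSlots : PolyTime PostedPrice.initialSlots := by
  refine map (f := fun B (x : List Entry × ℕ) => (nullOffer x.2,
      x.1.map (PostedPrice.entryOffer (PostedPrice.commonDen B) x.1 x.2))) ?_ (zipIdx id)
  refine prodMk (by unfold nullOffer; fun_prop) ?_
  exact map (f := fun (p : List (List Entry) × List Entry × ℕ) (e : Entry) =>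
    PostedPrice.entryOffer (PostedPrice.commonDen p.1) p.2.1 p.2.2 e) (by fun_prop) (by fun_prop)

@[fun_prop]
theorem slotsMass {s : α → List Slot} (hs : PolyTime s) :
    PolyTime fun a => PostedPrice.slotsMass (s a) :=
  (map (f := fun _ (x : Slot) => x.1.mass) (by fun_prop) hs).sum

@[fun_prop]
theorem upgrades {s : α → List Slot} (hs : PolyTime s) :
    PolyTime fun a => PostedPrice.upgrades (s a) := by
  refine (map (f := fun _ (x : Slot) => (x.2.filter fun o => decide (x.1.mass < o.mass ∧
    x.1.cost * x.1.mass < o.cost * o.mass)).map fun o => (x.1, o)) ?_ hs).flatten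
  refine map (f := fun (p : α × Slot) o => (p.2.1, o)) (by fun_prop) ?_
  exact filter (p := fun (p : α × Slot) (o : Offer) => decide (p.2.1.mass < o.mass ∧
    p.2.1.cost * p.2.1.mass < o.cost * o.mass)) (by fun_prop) (by fun_prop)

@[fun_prop]
theorem steepest {us : α → List (Offer × Offer)} (hus : PolyTime us) :
    PolyTime fun a => PostedPrice.steepest (us a) :=
  foldr_choose (p := fun _ => steeper) (by unfold steeper; fun_prop) hus (by fun_prop)

@[fun_prop]
theorem switchTo {s : α → List Slot} {o : α → Offer} (hs : PolyTime s) (ho : PolyTime o) :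
    PolyTime fun a => PostedPrice.switchTo (s a) (o a) :=
  map (f := fun a (x : Slot) => if x.1.buyer = (o a).buyer then (o a, x.2) else x)
    (by fun_prop) hs

theorem ascend : PolyTime fun x : (ℕ × List (List Entry)) × (List Slot × List Slot) =>
    PostedPrice.ascend x.1.1 (PostedPrice.commonDen x.1.2) x.2 := by
  unfold PostedPrice.ascend
  fun_prop

end PolyTime

theorem steepest_mem {us : List (Offer × Offer)} (h : us ≠ []) : steepest us ∈ us := by
  rcases List.mem_cons.1 (foldr_choose_mem steeper us (us.headD default)) with h' | h'
  · unfold steepest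
    rw [h']
    cases us with
    | nil => exact absurd rfl h
    | cons u us => simp
  · exact h'

theorem mem_upgrades {s : List Slot} {u : Offer × Offer} :
    u ∈ upgrades s ↔ ∃ x ∈ s, x.1 = u.1 ∧ u.2 ∈ x.2 ∧ u.1.mass < u.2.mass ∧
      u.1.cost * u.1.mass < u.2.cost * u.2.mass := by
  obtain ⟨v, w⟩ := u
  constructor
  · intro h
    obtain ⟨_, h, hu⟩ := List.mem_flatten.1 h
    obtain ⟨x, hx, rfl⟩ := List.mem_map.1 h
    obtain ⟨o, ho, ⟨⟩⟩ := List.mem_map.1 hu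
    obtain ⟨ho, h⟩ := List.mem_filter.1 ho
    exact ⟨x, hx, rfl, ho, of_decide_eq_true h⟩
  · rintro ⟨x, hx, rfl, ho, h⟩
    exact List.mem_flatten.2 ⟨_, List.mem_map_of_mem hx, List.mem_map.2
      ⟨w, List.mem_filter.2 ⟨ho, decide_eq_true h⟩, rfl⟩⟩

/-- A size bound that is preserved by the greedy algorithm. -/
def SlotsBounded (A n : ℕ) (s : List Slot) : Prop :=
  s.length = n ∧ ∀ x ∈ s, codeLen x.1 ≤ A ∧ codeLen x.2 ≤ A

theorem SlotsBounded.len_le {A n : ℕ} {s : List Slot} (h : SlotsBounded A n s) :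
    codeLen s ≤ n * (A + A + 1 + 1) + 1 :=
  codeLen_le_of_forall h.1.le fun x hx => by
    have := h.2 x hx
    have := codeLen_pair x.1 x.2
    rw [Prod.mk.eta] at this
    omega

theorem SlotsBounded.ascend {A n K D : ℕ} {p : List Slot × List Slot}
    (h₁ : SlotsBounded A n p.1) (h₂ : SlotsBounded A n p.2) :
    SlotsBounded A n (ascend K D p).1 ∧ SlotsBounded A n (ascend K D p).2 := by
  unfold PostedPrice.ascend
  split_ifs with h
  · exact ⟨h₁, h₂⟩
  · rw [not_or, List.isEmpty_iff] at h
    obtain ⟨x, hx, -, ho, -⟩ := mem_upgrades.1 (steepest_mem h.2)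
    refine ⟨h₂, by simp [switchTo, h₂.1], fun y hy => ?_⟩
    obtain ⟨z, hz, rfl⟩ := List.mem_map.1 hy
    have := h₂.2 z hz
    split_ifs
    · exact ⟨(codeLen_mem ho).le.trans (h₂.2 x hx).2, this.2⟩
    · exact this

namespace PolyTime

variable {α : Type} [HasCode α]

@[fun_prop]
theorem finalStates : PolyTime fun x : ℕ × List (List Entry) =>
    PostedPrice.finalStates x.1 x.2 := by
  have hi : PolyBound fun x : ℕ × List (List Entry) => codeLen (PostedPrice.initialSlots x.2) := by
    fun_prop
  refine iterate_length (l := fun x : ℕ × List (List Entry) => x.2.flatten)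
    (B := fun x => let A := codeLen (PostedPrice.initialSlots x.2)
      (A * (A + A + 1 + 1) + 1) + (A * (A + A + 1 + 1) + 1) + 1)
    ascend (by fun_prop) (by fun_prop) (by simp only; fun_prop) fun x k => ?_
  set s := PostedPrice.initialSlots x.2
  have : ∀ k, SlotsBounded (codeLen s) s.length
        ((PostedPrice.ascend x.1 (PostedPrice.commonDen x.2))^[k] (s, s)).1 ∧
      SlotsBounded (codeLen s) s.length
        ((PostedPrice.ascend x.1 (PostedPrice.commonDen x.2))^[k] (s, s)).2 := by
    intro k
    induction k with
    | zero =>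
      have : SlotsBounded (codeLen s) s.length s := by
        refine ⟨rfl, fun y hy => ?_⟩
        have := codeLen_mem hy
        have := codeLen_pair y.1 y.2
        rw [Prod.mk.eta] at this
        omega
      exact ⟨this, this⟩
    | succ k ih =>
      rw [Function.iterate_succ_apply']
      exact ih.1.ascend ih.2
  have h₁ := (this k).1.len_le
  have h₂ := (this k).2.len_le
  have h₃ := Nat.mul_le_mul_right (codeLen s + codeLen s + 1 + 1)
    (length_lt_codeLen s).le
  rw [← Prod.mk.eta (p := (PostedPrice.ascend _ _)^[k] _), codeLen_pair]
  simp only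
  omega

@[fun_prop]
theorem sortedOffers {s : α → List Slot} (hs : PolyTime s) :
    PolyTime fun a => PostedPrice.sortedOffers (s a) :=
  insertionSort (r := fun o o' : Offer => o'.cost ≤ o.cost) (by fun_prop)
    (map (f := fun _ (x : Slot) => x.1) (by fun_prop) hs)

@[fun_prop]
theorem outputOffers {s : α → List Slot} (hs : PolyTime s) :
    PolyTime fun a => PostedPrice.outputOffers (s a) :=
  map (f := fun _ (o : Offer) => (o.buyer, o.price)) (by fun_prop) (sortedOffers hs)

theorem replicate_min {K : α → ℕ} {β : Type} [HasCode β] {l : α → List β} (hK : PolyTime K)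
    (hl : PolyTime l) : PolyTime fun a => List.replicate (min (K a) (l a).length) 0 := by
  refine listRec (F := fun a (m : List β) => List.replicate (min (K a) m.length) 0)
    (B := fun a => codeLen (l a) * (1 + 1) + 1) (fun _ => [])
    (fun a _ _ r => if r.length < K a then 0 :: r else r) (fun _ => by simp) (fun a y m => ?_)
    (by fun_prop) hl ?_ (by fun_prop) fun a m hm => ?_
  · rw [List.length_replicate, List.length_cons]
    split_ifs with h
    · rw [← List.replicate_succ]
      congr 1
      omega
    · congr 1
      omega
  · have : PolyTime fun p : α × β × List β × List ℕ => K p.1 := hK.comp (by fun_prop)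
    fun_prop
  · refine codeLen_le_of_forall ?_ fun x hx => ?_
    · rw [List.length_replicate]
      have := hm.length_le
      have := length_lt_codeLen (l a)
      omega
    · rw [List.eq_of_mem_replicate hx]
      simp [codeLen_nat]

theorem revenueRow : PolyTime fun x : (ℕ × ℕ × Offer) × List ℕ =>
    PostedPrice.revenueRow x.1.1 x.1.2.1 x.1.2.2 x.2 := by
  let f : (ℕ × ℕ × Offer) × ℕ × ℕ → ℕ := fun p =>
    p.1.2.2.mass * (p.1.2.2.cost * p.1.2.1 + p.2.2) + (p.1.1 - p.1.2.2.mass) * p.2.1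
  have hf : PolyTime f := by fun_prop
  obtain ⟨q, hq⟩ := hf.len
  refine listRec (F := fun (x : (ℕ × ℕ × Offer) × List ℕ) m =>
      PostedPrice.revenueRow x.1.1 x.1.2.1 x.1.2.2 m)
    (B := fun x => codeLen x * (q.eval (3 * codeLen x + 4) + 1) + 1)
    (fun _ => []) (fun x y m r => f (x.1, y, m.headD 0) :: r) (fun _ => rfl) (fun _ _ _ => rfl)
    (by fun_prop) (by fun_prop) (by fun_prop) ?_ fun x m hm => ?_
  · exact (PolyBound.len_self.mul (((((PolyBound.const 3).mul PolyBound.len_self).add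
      (.const 4)).eval q).add (.const 1))).add (.const 1)
  · have hx := codeLen_pair x.1 x.2
    rw [Prod.mk.eta] at hx
    refine codeLen_le_of_forall ?_ ?_
    · rw [length_revenueRow]
      have := length_lt_codeLen m
      have := codeLen_sublist hm.sublist
      omega
    · have hl := codeLen_sublist hm.sublist
      clear hm
      induction m with
      | nil => intro z hz; simp [PostedPrice.revenueRow] at hz
      | cons y m ih =>
        intro z hz
        rw [codeLen_cons] at hl
        rcases List.mem_cons.1 hz with rfl | h
        · refine (hq (x.1, y, m.headD 0)).trans (monotone_eval_nat q ?_)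
          have : codeLen (m.headD 0) ≤ codeLen m + 2 := by
            cases m with
            | nil => simp [codeLen_nat]
            | cons => rw [List.headD_cons, codeLen_cons]; omega
          rw [codeLen_pair x.1, codeLen_pair y]
          omega
        · exact ih (by omega) z h

end PolyTime

theorem revenueRow_le {D S w c : ℕ} {o : Offer} (hD : D ≤ 2 ^ w) (hp : o.cost ≤ 2 ^ w)
    (hm : o.mass ≤ 2 ^ w) (hw : 2 ≤ w) (hS : S ≤ 2 ^ c) {l : List ℕ}
    (hl : ∀ x ∈ l, x ≤ 2 ^ c) : ∀ x ∈ revenueRow D S o l, x ≤ 2 ^ (c + 3 * w) := by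
  induction l with
  | nil => intro x hx; simp [revenueRow] at hx
  | cons y l ih =>
    intro x hx
    rcases List.mem_cons.1 hx with rfl | h
    · have h₁ : l.headD 0 ≤ 2 ^ c := by
        cases l with
        | nil => simp
        | cons z l => exact hl z (by simp)
      have h₂ : y ≤ 2 ^ c := hl y (by simp)
      have h₃ : D - o.mass ≤ 2 ^ w := (Nat.sub_le _ _).trans hD
      have h₄ : 2 ^ 2 ≤ 2 ^ w := Nat.pow_le_pow_right (by norm_num) hw
      calc _ ≤ 2 ^ w * (2 ^ w * 2 ^ c + 2 ^ c) + 2 ^ w * 2 ^ c := by gcongr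
        _ ≤ 2 ^ (c + 3 * w) := by
          rw [pow_add, pow_mul']
          generalize 2 ^ w = a at *
          generalize 2 ^ c = b at *
          have h5 : a * a + 2 * a ≤ a ^ 3 := by nlinarith
          calc _ = b * (a * a + 2 * a) := by ring
            _ ≤ _ := Nat.mul_le_mul_left _ h5
    · exact ih (fun x hx => hl x (by simp [hx])) x h

theorem revenueTable_le {D w : ℕ} {z : List ℕ} {l : List Offer} (hD : D ≤ 2 ^ w) (hw : 2 ≤ w)
    (hz : ∀ x ∈ z, x = 0) (hl : ∀ o ∈ l, o.cost ≤ 2 ^ w ∧ o.mass ≤ 2 ^ w) :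
    (revenueTable D z l).1 ≤ 2 ^ (l.length * (3 * w)) ∧
      (revenueTable D z l).2.length = z.length ∧
      ∀ x ∈ (revenueTable D z l).2, x ≤ 2 ^ (l.length * (3 * w)) := by
  induction l with
  | nil => exact ⟨by simp [revenueTable], rfl, fun x hx => by simp [hz x hx]⟩
  | cons o l ih =>
    obtain ⟨h₁, h₂, h₃⟩ := ih fun o ho => hl o (by simp [ho])
    have ho := hl o (by simp)
    rw [List.length_cons, add_mul, one_mul]
    refine ⟨?_, (length_revenueRow _ _ _ _).trans h₂, revenueRow_le hD ho.1 ho.2 hw h₁ h₃⟩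
    rw [pow_add, mul_comm]
    exact Nat.mul_le_mul (hD.trans (Nat.pow_le_pow_right (by norm_num) (by omega))) h₁

namespace PolyTime

variable {α : Type} [HasCode α]

theorem revenueTable {D : α → ℕ} {z : α → List ℕ} {l : α → List Offer} (hD : PolyTime D)
    (hz : PolyTime z) (hl : PolyTime l) (h0 : ∀ a, ∀ x ∈ z a, x = 0) :
    PolyTime fun a => PostedPrice.revenueTable (D a) (z a) (l a) := by
  refine listRec (F := fun a m => PostedPrice.revenueTable (D a) (z a) m)
    (B := fun a =>
      let C := codeLen (l a) * (3 * (codeLen (D a) + codeLen (l a))) + 2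
      C + (codeLen (z a) * (C + 1) + 1) + 1)
    (fun a => (1, z a))
    (fun a o _ r => (D a * r.1, PostedPrice.revenueRow (D a) r.1 o r.2)) (fun _ => rfl)
    (fun _ _ _ => rfl) (by fun_prop) hl ?_ (by simp only; fun_prop) fun a m hm => ?_
  · have hD' : PolyTime fun p : α × Offer × List Offer × ℕ × List ℕ => D p.1 :=
      hD.comp (by fun_prop)
    exact prodMk (by fun_prop) (revenueRow.comp
      (f := fun p : α × Offer × List Offer × ℕ × List ℕ =>
        ((D p.1, p.2.2.2.1, p.2.1), p.2.2.2.2)) (by fun_prop))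
  · have hpow : ∀ {x y : ℕ}, x.size ≤ y → x ≤ 2 ^ y := fun h => (Nat.size_le.1 h).le
    have hw := one_le_codeLen (D a)
    have hw' := one_le_codeLen (l a)
    obtain ⟨h₁, h₂, h₃⟩ := revenueTable_le (D := D a) (z := z a) (l := m)
      (w := codeLen (D a) + codeLen (l a))
      (hpow (by rw [codeLen_nat]; omega)) (by omega) (h0 a) fun o ho => by
        have := codeLen_mem (hm.subset ho)
        have h : codeLen o = codeLen (o.buyer, o.price, o.cost, o.mass) := rfl
        rw [codeLen_pair o.buyer, codeLen_pair o.price, codeLen_pair o.cost,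
          codeLen_nat o.cost, codeLen_nat o.mass] at h
        exact ⟨hpow (by omega), hpow (by omega)⟩
    have hC : ∀ x, x ≤ 2 ^ (m.length * (3 * (codeLen (D a) + codeLen (l a)))) →
        codeLen x ≤ codeLen (l a) *
          (3 * (codeLen (D a) + codeLen (l a))) + 2 := by
      intro x hx
      rw [codeLen_nat]
      have : x.size ≤ codeLen (l a) *
          (3 * (codeLen (D a) + codeLen (l a))) + 1 := by
        rw [Nat.size_le]
        refine hx.trans_lt (Nat.pow_lt_pow_right (by norm_num) (Nat.lt_succ_of_le ?_))
        exact Nat.mul_le_mul_right _ (hm.length_le.trans (length_lt_codeLen _).le)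
      omega
    rw [← Prod.mk.eta (p := PostedPrice.revenueTable _ _ _), codeLen_pair]
    have h4 := hC _ h₁
    have h5 := codeLen_le_of_forall (h₂.trans_le (length_lt_codeLen (z a)).le)
      fun x hx => hC x (h₃ x hx)
    simp only
    omega

@[fun_prop]
theorem scaledRevenue {K D : α → ℕ} {s : α → List Slot} (hK : PolyTime K) (hD : PolyTime D)
    (hs : PolyTime s) : PolyTime fun a => PostedPrice.scaledRevenue (K a) (D a) (s a) := by
  have := revenueTable hD (replicate_min hK hs) (sortedOffers hs)
    fun a x hx => List.eq_of_mem_replicate hx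
  unfold PostedPrice.scaledRevenue
  fun_prop

theorem bestOffers : PolyTime PostedPrice.bestOffers := by
  unfold PostedPrice.bestOffers
  fun_prop

end PolyTime

/-! ### Poisson variables capped at the number of copies -/

/-- The probability that a Poisson variable of mean `x` is at most `k`. -/
noncomputable def poissonCDF (k : ℕ) (x : ℝ) : ℝ :=
  Real.exp (-x) * ∑ i ∈ Finset.range (k + 1), x ^ i / (i.factorial : ℝ)

/-- The expectation of the minimum of `k` and a Poisson variable of mean `x`. -/
noncomputable def poissonCapped (k : ℕ) (x : ℝ) : ℝ :=
  ∑ j ∈ Finset.range k, (1 - poissonCDF j x)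

theorem poissonCDF_succ (k : ℕ) (x : ℝ) : poissonCDF (k + 1) x =
    poissonCDF k x + Real.exp (-x) * (x ^ (k + 1) / ((k + 1).factorial : ℝ)) := by
  rw [poissonCDF, Finset.sum_range_succ, mul_add, poissonCDF]

theorem hasDerivAt_poissonCDF (k : ℕ) (x : ℝ) :
    HasDerivAt (poissonCDF k) (-(Real.exp (-x) * (x ^ k / (k.factorial : ℝ)))) x := by
  have he : HasDerivAt (fun x : ℝ => Real.exp (-x)) (-Real.exp (-x)) x := by
    simpa using (hasDerivAt_neg x).exp
  induction k with
  | zero =>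
    have : poissonCDF 0 = fun x : ℝ => Real.exp (-x) := by funext y; simp [poissonCDF]
    rw [this]
    simpa using he
  | succ k ih =>
    have h : poissonCDF (k + 1) = fun x => poissonCDF k x +
        Real.exp (-x) * (x ^ (k + 1) / ((k + 1).factorial : ℝ)) := funext (poissonCDF_succ k)
    rw [h]
    have hp : HasDerivAt (fun x : ℝ => x ^ (k + 1) / ((k + 1).factorial : ℝ))
        (x ^ k / (k.factorial : ℝ)) x := by
      refine ((hasDerivAt_pow (k + 1) x).div_const ((k + 1).factorial : ℝ)).congr_deriv ?_
      have : (k.factorial : ℝ) ≠ 0 := by positivity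
      rw [Nat.factorial_succ]
      push_cast
      field_simp
    refine (ih.add (he.mul hp)).congr_deriv ?_
    ring

theorem poissonCDF_antitoneOn (k : ℕ) : AntitoneOn (poissonCDF k) (Set.Ici 0) := by
  refine antitoneOn_of_deriv_nonpos (convex_Ici 0)
    (fun x _ => (hasDerivAt_poissonCDF k x).continuousAt.continuousWithinAt)
    (fun x _ => (hasDerivAt_poissonCDF k x).differentiableAt.differentiableWithinAt)
    fun x hx => ?_
  rw [interior_Ici, Set.mem_Ioi] at hx
  rw [(hasDerivAt_poissonCDF k x).deriv, neg_nonpos]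
  positivity

theorem poissonCapped_succ (k : ℕ) (x : ℝ) :
    poissonCapped (k + 1) x = poissonCapped k x + (1 - poissonCDF k x) :=
  Finset.sum_range_succ _ _

theorem hasDerivAt_poissonCapped (k : ℕ) (x : ℝ) :
    HasDerivAt (poissonCapped (k + 1)) (poissonCDF k x) x := by
  induction k with
  | zero =>
    have h : poissonCapped (0 + 1) = fun x => 1 - poissonCDF 0 x := by
      funext y; simp [poissonCapped]
    rw [h]
    refine ((hasDerivAt_poissonCDF 0 x).const_sub 1).congr_deriv ?_
    simp [poissonCDF]
  | succ k ih =>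
    rw [funext (poissonCapped_succ (k + 1))]
    refine (ih.add ((hasDerivAt_poissonCDF (k + 1) x).const_sub 1)).congr_deriv ?_
    rw [poissonCDF_succ, neg_neg]

/-- Tangents lie above the graph of `poissonCapped`. -/
theorem poissonCapped_add_le (k : ℕ) {x y : ℝ} (hx : 0 ≤ x) (hy : 0 ≤ y) :
    poissonCapped (k + 1) (x + y) ≤ poissonCapped (k + 1) x + y * poissonCDF k x := by
  have h := (convex_Icc x (x + y)).image_sub_le_mul_sub_of_deriv_le
    (f := poissonCapped (k + 1)) (C := poissonCDF k x)
    (fun z _ => (hasDerivAt_poissonCapped k z).continuousAt.continuousWithinAt)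
    (fun z _ => (hasDerivAt_poissonCapped k z).differentiableAt.differentiableWithinAt)
    (fun z hz => by
      rw [interior_Icc, Set.mem_Ioo] at hz
      rw [(hasDerivAt_poissonCapped k z).deriv]
      exact poissonCDF_antitoneOn k hx (hx.trans hz.1.le) hz.1.le)
    x (by simp [hy]) (x + y) (by simp [hy]) (by linarith)
  rw [add_sub_cancel_left] at h
  linarith

theorem poissonCapped_zero_right (k : ℕ) : poissonCapped k 0 = 0 := by
  have h : ∀ j, poissonCDF j 0 = 1 := by
    intro j
    induction j with
    | zero => simp [poissonCDF]
    | succ j ih => rw [poissonCDF_succ, ih]; simp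
  simp [poissonCapped, h]

theorem poissonCapped_concaveOn (k : ℕ) : ConcaveOn ℝ (Set.Ici 0) (poissonCapped (k + 1)) := by
  refine AntitoneOn.concaveOn_of_deriv (convex_Ici 0)
    (fun x _ => (hasDerivAt_poissonCapped k x).continuousAt.continuousWithinAt)
    (fun x _ => (hasDerivAt_poissonCapped k x).differentiableAt.differentiableWithinAt) ?_
  have : deriv (poissonCapped (k + 1)) = poissonCDF k :=
    funext fun x => (hasDerivAt_poissonCapped k x).deriv
  rw [this]
  exact (poissonCDF_antitoneOn k).mono interior_subset

theorem poissonCapped_eq (k : ℕ) (x : ℝ) : poissonCapped k x =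
    k - (k - x) * poissonCDF k x - Real.exp (-x) * (x ^ (k + 1) / (k.factorial : ℝ)) := by
  induction k with
  | zero => simp [poissonCapped, poissonCDF]; ring
  | succ k ih =>
    have : (k.factorial : ℝ) ≠ 0 := by positivity
    rw [poissonCapped_succ, ih, poissonCDF_succ, Nat.factorial_succ]
    push_cast
    field_simp
    ring

theorem poissonCapped_self (K : ℕ) : poissonCapped K K = K * guarantee K := by
  rw [poissonCapped_eq, guarantee, Real.exp_neg, pow_succ]
  have : (K.factorial : ℝ) ≠ 0 := by positivity
  field_simp
  ring

/-- By concavity, the ratio of `poissonCapped K x` and `x` is smallest at `x = K`. -/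
theorem guarantee_mul_le_poissonCapped {K : ℕ} (hK : 1 ≤ K) {x : ℝ} (hx : 0 ≤ x) (hxK : x ≤ K) :
    guarantee K * x ≤ poissonCapped K x := by
  obtain ⟨k, rfl⟩ := Nat.exists_eq_add_of_le' hK
  have hK' : (0 : ℝ) < ((k + 1 : ℕ) : ℝ) := by positivity
  have ha : 0 ≤ 1 - x / ((k + 1 : ℕ) : ℝ) := by rwa [sub_nonneg, div_le_one hK']
  have hb : 0 ≤ x / ((k + 1 : ℕ) : ℝ) := by positivity
  have h := (poissonCapped_concaveOn k).2 (Set.mem_Ici.2 le_rfl) (Set.mem_Ici.2 hK'.le) ha hb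
    (sub_add_cancel _ _)
  rw [poissonCapped_zero_right, poissonCapped_self, smul_zero, zero_add, zero_add,
    smul_eq_mul, smul_eq_mul, div_mul_cancel₀ _ hK'.ne', ← mul_assoc,
    div_mul_cancel₀ _ hK'.ne'] at h
  linarith

theorem one_sub_le_guarantee {K : ℕ} (hK : 1 ≤ K) :
    1 - 1 / Real.sqrt (2 * Real.pi * (K : ℝ)) ≤ guarantee K := by
  have hK' : (0 : ℝ) < K := by exact_mod_cast hK
  have h := Stirling.le_factorial_stirling K
  have hs : 0 < Real.sqrt (2 * Real.pi * (K : ℝ)) := by positivity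
  rw [guarantee, sub_le_sub_iff_left, div_le_div_iff₀ (by positivity) hs, one_mul]
  calc (K : ℝ) ^ K * Real.sqrt (2 * Real.pi * K)
      = Real.sqrt (2 * Real.pi * K) * (K / Real.exp 1) ^ K * Real.exp K := by
        rw [div_pow, ← Real.exp_nat_mul, mul_one]
        field_simp
    _ ≤ _ := mul_le_mul_of_nonneg_right h (Real.exp_pos _).le

theorem guarantee_pos {K : ℕ} (hK : 1 ≤ K) : 0 < guarantee K := by
  refine lt_of_lt_of_le ?_ (one_sub_le_guarantee hK)
  have hK' : (1 : ℝ) ≤ K := by exact_mod_cast hK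
  have : 1 < Real.sqrt (2 * Real.pi * (K : ℝ)) := by
    rw [Real.lt_sqrt (by norm_num)]
    nlinarith [Real.pi_gt_three]
  rw [sub_pos, div_lt_one (by linarith)]
  exact this

/-! ### Revenue of a list of offers, and numbers of acceptances -/

/-- The expected revenue from `k` copies and offers with given prices and probabilities of
acceptance. -/
noncomputable def listRevenue : ℕ → List (ℝ × ℝ) → ℝ
  | 0, _ => 0
  | _ + 1, [] => 0
  | k + 1, (p, q) :: l => q * (p + listRevenue k l) + (1 - q) * listRevenue (k + 1) l

/-- The expectation of the minimum of `k` and a sum of independent Bernoulli variables. -/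
noncomputable def bernoulliCapped : ℕ → List ℝ → ℝ
  | 0, _ => 0
  | _ + 1, [] => 0
  | k + 1, q :: l => q * (1 + bernoulliCapped k l) + (1 - q) * bernoulliCapped (k + 1) l

theorem bernoulliCapped_nil (k : ℕ) : bernoulliCapped k [] = 0 := by
  cases k <;> rfl

theorem bernoulliCapped_zeros (k : ℕ) {l : List ℝ} (hl : ∀ q ∈ l, q = 0) :
    bernoulliCapped k l = 0 := by
  induction l with
  | nil => exact bernoulliCapped_nil k
  | cons q l ih =>
    cases k with
    | zero => rfl
    | succ k =>
      rw [bernoulliCapped, hl q (by simp), ih fun x hx => hl x (by simp [hx])]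
      ring

theorem bernoulliCapped_perm (k : ℕ) {l m : List ℝ} (h : l.Perm m) :
    bernoulliCapped k l = bernoulliCapped k m := by
  induction h generalizing k with
  | nil => rfl
  | cons x _ ih =>
    cases k with
    | zero => rfl
    | succ k => rw [bernoulliCapped, bernoulliCapped, ih, ih]
  | swap x y l =>
    rcases k with _ | _ | k
    · rfl
    · simp only [bernoulliCapped]; ring
    · simp only [bernoulliCapped]; ring
  | trans _ _ ih₁ ih₂ => rw [ih₁, ih₂]

/-- One more copy leads to at most one more sale. -/
theorem bernoulliCapped_succ_sub (k : ℕ) {l : List ℝ} (hl : ∀ q ∈ l, 0 ≤ q ∧ q ≤ 1) :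
    bernoulliCapped k l ≤ bernoulliCapped (k + 1) l ∧
      bernoulliCapped (k + 1) l ≤ bernoulliCapped k l + 1 := by
  induction l generalizing k with
  | nil => simp [bernoulliCapped_nil]
  | cons q l ih =>
    have hq := hl q (by simp)
    have hl' : ∀ q ∈ l, 0 ≤ q ∧ q ≤ 1 := fun x hx => hl x (by simp [hx])
    obtain ⟨a, b⟩ := ih k hl'
    cases k with
    | zero =>
      simp only [bernoulliCapped] at a b ⊢
      constructor <;> nlinarith
    | succ k =>
      obtain ⟨c, d⟩ := ih k hl'
      simp only [bernoulliCapped]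
      constructor <;> nlinarith

theorem bernoulliCapped_mono (k : ℕ) {l m : List ℝ} (h : List.Forall₂ (· ≤ ·) l m)
    (hl : ∀ q ∈ l, 0 ≤ q) (hm : ∀ q ∈ m, q ≤ 1) : bernoulliCapped k l ≤ bernoulliCapped k m := by
  induction h generalizing k with
  | nil => rfl
  | @cons q r l m hqr h ih =>
    cases k with
    | zero => rfl
    | succ k =>
      have hl' : ∀ q ∈ l, 0 ≤ q := fun x hx => hl x (by simp [hx])
      have hm' : ∀ q ∈ m, q ≤ 1 := fun x hx => hm x (by simp [hx])
      have hq := hl q (by simp)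
      have hr := hm r (by simp)
      have hm'' : ∀ q ∈ m, 0 ≤ q ∧ q ≤ 1 := by
        intro x hx
        obtain ⟨i, hi, rfl⟩ := List.mem_iff_getElem.1 hx
        exact ⟨(hl' _ (List.getElem_mem (h.length_eq ▸ hi))).trans (h.get _ hi), hm' _ hx⟩
      have h₁ := ih k hl' hm'
      have h₂ := ih (k + 1) hl' hm'
      have h₃ := bernoulliCapped_succ_sub k hm''
      simp only [bernoulliCapped]
      nlinarith

/-- Sums of independent Bernoulli variables are capped less often than Poisson variables of the
same mean. -/
theorem poissonCapped_le_bernoulliCapped (k : ℕ) {l : List ℝ} (hl : ∀ q ∈ l, 0 ≤ q ∧ q ≤ 1) :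
    poissonCapped k l.sum ≤ bernoulliCapped k l := by
  induction l generalizing k with
  | nil => simp [bernoulliCapped_nil, poissonCapped_zero_right]
  | cons q l ih =>
    have hq := hl q (by simp)
    have hl' : ∀ q ∈ l, 0 ≤ q ∧ q ≤ 1 := fun x hx => hl x (by simp [hx])
    cases k with
    | zero => simp [poissonCapped, bernoulliCapped]
    | succ k =>
      have h₁ := ih k hl'
      have h₂ := ih (k + 1) hl'
      have h₃ := poissonCapped_add_le k (List.sum_nonneg fun x hx => (hl' x hx).1) hq.1
      have h₄ := poissonCapped_succ k l.sum
      rw [List.sum_cons, add_comm q, bernoulliCapped]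
      nlinarith

theorem guarantee_mul_sum_le {K : ℕ} (hK : 1 ≤ K) {l : List ℝ} (hl : ∀ q ∈ l, 0 ≤ q ∧ q ≤ 1)
    (hs : l.sum ≤ K) : guarantee K * l.sum ≤ bernoulliCapped K l :=
  (guarantee_mul_le_poissonCapped hK (List.sum_nonneg fun x hx => (hl x hx).1) hs).trans
    (poissonCapped_le_bernoulliCapped K hl)

/-- The probabilities of acceptance of the offers with prices at least `θ`. -/
noncomputable def massesAbove (θ : ℝ) (l : List (ℝ × ℝ)) : List ℝ :=
  l.map fun o => if θ ≤ o.1 then o.2 else 0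

/-- Prices are nonnegative and acceptance probabilities are probabilities. -/
def IsOfferList (l : List (ℝ × ℝ)) : Prop := ∀ o ∈ l, 0 ≤ o.1 ∧ 0 ≤ o.2 ∧ o.2 ≤ 1

theorem IsOfferList.massesAbove {l : List (ℝ × ℝ)} (hl : IsOfferList l) (θ : ℝ) :
    ∀ q ∈ massesAbove θ l, 0 ≤ q ∧ q ≤ 1 := by
  intro q hq
  obtain ⟨o, ho, rfl⟩ := List.mem_map.1 hq
  have := hl o ho
  split_ifs
  · exact this.2
  · simp

theorem antitone_bernoulliCapped_massesAbove (k : ℕ) {l : List (ℝ × ℝ)} (hl : IsOfferList l) :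
    Antitone fun θ => bernoulliCapped k (massesAbove θ l) := by
  intro θ η h
  refine bernoulliCapped_mono k ?_ (fun q hq => (hl.massesAbove η q hq).1)
    fun q hq => (hl.massesAbove θ q hq).2
  unfold massesAbove
  rw [List.forall₂_map_left_iff, List.forall₂_map_right_iff, List.forall₂_same]
  intro o ho
  have := hl o ho
  split_ifs with h₁ h₂
  · rfl
  · exact absurd (h.trans h₁) h₂
  · exact this.2.1
  · rfl

theorem integral_indicator_price {p b : ℝ} (hp : 0 ≤ p) (hpb : p ≤ b) :
    IntervalIntegrable (fun θ => if θ ≤ p then (1 : ℝ) else 0) MeasureTheory.volume 0 b ∧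
      ∫ θ in (0 : ℝ)..b, (if θ ≤ p then (1 : ℝ) else 0) = p := by
  constructor
  · refine Antitone.intervalIntegrable fun θ η h => ?_
    split_ifs with h₁ h₂
    · rfl
    · exact absurd (h.trans h₁) h₂
    · exact zero_le_one
    · rfl
  · have := intervalIntegral.integral_indicator (μ := MeasureTheory.volume) (f := fun _ => (1 : ℝ))
      (⟨hp, hpb⟩ : p ∈ Set.Icc 0 b)
    simpa [Set.indicator] using this

/-- If prices decrease, the revenue is the integral over `θ` of the expected number of sales at
prices at least `θ`, which is the capped number of acceptances of these prices. -/
theorem listRevenue_eq_integral (k : ℕ) {b : ℝ} {l : List (ℝ × ℝ)} (hl : IsOfferList l)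
    (hb : ∀ o ∈ l, o.1 ≤ b) (hs : l.Pairwise fun o o' => o'.1 ≤ o.1) :
    listRevenue k l = ∫ θ in (0 : ℝ)..b, bernoulliCapped k (massesAbove θ l) := by
  induction l generalizing k with
  | nil => cases k <;> simp [listRevenue, massesAbove, bernoulliCapped]
  | cons o l ih =>
    obtain ⟨p, q⟩ := o
    rw [List.pairwise_cons] at hs
    have hl' : IsOfferList l := fun o ho => hl o (by simp [ho])
    have hb' : ∀ o ∈ l, o.1 ≤ b := fun o ho => hb o (by simp [ho])
    cases k with
    | zero => simp [listRevenue, bernoulliCapped]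
    | succ k =>
      have hstep : ∀ θ, bernoulliCapped (k + 1) (massesAbove θ ((p, q) :: l)) =
          q * ((if θ ≤ p then 1 else 0) + bernoulliCapped k (massesAbove θ l)) +
            (1 - q) * bernoulliCapped (k + 1) (massesAbove θ l) := by
        intro θ
        unfold massesAbove
        rw [List.map_cons, bernoulliCapped]
        split_ifs with h
        · rfl
        · -- The prices after `p` are not larger, so that none of them reaches `θ`.
          have hz : ∀ q ∈ l.map fun o => if θ ≤ o.1 then o.2 else 0, q = 0 := by
            intro q hq
            obtain ⟨o, ho, rfl⟩ := List.mem_map.1 hq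
            exact if_neg fun h' => h (h'.trans (hs.1 o ho))
          rw [bernoulliCapped_zeros k hz, bernoulliCapped_zeros (k + 1) hz]
          ring
      have hp := integral_indicator_price (hl (p, q) (by simp)).1 (hb (p, q) (by simp))
      have hk : ∀ k, IntervalIntegrable (fun θ => bernoulliCapped k (massesAbove θ l))
          MeasureTheory.volume 0 b :=
        fun k => (antitone_bernoulliCapped_massesAbove k hl').intervalIntegrable
      rw [intervalIntegral.integral_congr fun θ _ => hstep θ,
        intervalIntegral.integral_add ((hp.1.add (hk k)).const_mul q) ((hk _).const_mul _),
        intervalIntegral.integral_const_mul, intervalIntegral.integral_const_mul,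
        intervalIntegral.integral_add hp.1 (hk k), hp.2, ← ih k hl' hb' hs.2,
        ← ih (k + 1) hl' hb' hs.2, listRevenue]

theorem integral_sum_massesAbove {b : ℝ} {l : List (ℝ × ℝ)} (hl : IsOfferList l)
    (hb : ∀ o ∈ l, o.1 ≤ b) :
    IntervalIntegrable (fun θ => (massesAbove θ l).sum) MeasureTheory.volume 0 b ∧
      ∫ θ in (0 : ℝ)..b, (massesAbove θ l).sum = (l.map fun o => o.1 * o.2).sum := by
  induction l with
  | nil => simp [massesAbove]
  | cons o l ih =>
    obtain ⟨ih₁, ih₂⟩ := ih (fun o ho => hl o (by simp [ho])) fun o ho => hb o (by simp [ho])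
    have hp := integral_indicator_price (hl o (by simp)).1 (hb o (by simp))
    have hstep : ∀ θ, (massesAbove θ (o :: l)).sum =
        o.2 * (if θ ≤ o.1 then 1 else 0) + (massesAbove θ l).sum := by
      intro θ
      simp [massesAbove]
    simp only [hstep]
    refine ⟨(hp.1.const_mul _).add ih₁, ?_⟩
    rw [intervalIntegral.integral_add (hp.1.const_mul _) ih₁, ih₂,
      intervalIntegral.integral_const_mul, hp.2, List.map_cons, List.sum_cons, mul_comm]

/-- Raising acceptance probabilities does not lower the revenue if prices decrease. -/
theorem listRevenue_mono (k : ℕ) {l m : List (ℝ × ℝ)} (hl : IsOfferList l) (hm : IsOfferList m)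
    (h : List.Forall₂ (fun o o' => o.1 = o'.1 ∧ o.2 ≤ o'.2) l m)
    (hs : l.Pairwise fun o o' => o'.1 ≤ o.1) (hs' : m.Pairwise fun o o' => o'.1 ≤ o.1) :
    listRevenue k l ≤ listRevenue k m := by
  obtain ⟨b, hb⟩ : ∃ b : ℝ, ∀ o ∈ l ++ m, o.1 ≤ b :=
    ⟨((l ++ m).map fun o => o.1).sum, fun o ho => List.single_le_sum (by
      intro x hx
      obtain ⟨o, ho, rfl⟩ := List.mem_map.1 hx
      rcases List.mem_append.1 ho with ho | ho
      · exact (hl o ho).1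
      · exact (hm o ho).1) _ (List.mem_map_of_mem ho)⟩
  rcases m with _ | ⟨o, m'⟩
  · rw [List.forall₂_nil_right_iff.1 h]
  have hb0 : 0 ≤ b := (hm o (by simp)).1.trans (hb o (by simp))
  rw [listRevenue_eq_integral k hl (fun o ho => hb o (List.mem_append_left _ ho)) hs,
    listRevenue_eq_integral k hm (fun o ho => hb o (List.mem_append_right _ ho)) hs']
  refine intervalIntegral.integral_mono hb0
    (antitone_bernoulliCapped_massesAbove k hl).intervalIntegrable
    (antitone_bernoulliCapped_massesAbove k hm).intervalIntegrable fun θ => ?_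
  refine bernoulliCapped_mono k ?_ (fun q hq => (hl.massesAbove θ q hq).1)
    fun q hq => (hm.massesAbove θ q hq).2
  unfold massesAbove
  rw [List.forall₂_map_left_iff, List.forall₂_map_right_iff]
  have hl0 : ∀ o ∈ l, 0 ≤ o.2 := fun o ho => (hl o ho).2.1
  refine h.imp fun o o' h => ?_
  rw [h.1]
  split_ifs
  · exact h.2
  · rfl

/-- Mixing two lists of offers that differ in one offer. In the mixture of the numbers of
acceptances, this offer is again a Bernoulli variable. -/
theorem guarantee_mul_mixture_le {K : ℕ} (hK : 1 ≤ K) {l l' r : List (ℝ × ℝ)} {a a' : ℝ × ℝ}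
    (hl : IsOfferList l) (hl' : IsOfferList l') (hs : l.Pairwise fun o o' => o'.1 ≤ o.1)
    (hs' : l'.Pairwise fun o o' => o'.1 ≤ o.1) (h : l.Perm (a :: r)) (h' : l'.Perm (a' :: r))
    {t : ℝ} (ht : 0 ≤ t) (ht' : t ≤ 1)
    (hmass : (1 - t) * (l.map Prod.snd).sum + t * (l'.map Prod.snd).sum ≤ K) :
    guarantee K * ((1 - t) * (l.map fun o => o.1 * o.2).sum +
      t * (l'.map fun o => o.1 * o.2).sum) ≤
      (1 - t) * listRevenue K l + t * listRevenue K l' := by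
  obtain ⟨b, hb⟩ : ∃ b : ℝ, ∀ o ∈ l ++ l', o.1 ≤ b :=
    ⟨((l ++ l').map fun o => o.1).sum, fun o ho => List.single_le_sum (by
      intro x hx
      obtain ⟨o, ho, rfl⟩ := List.mem_map.1 hx
      rcases List.mem_append.1 ho with ho | ho
      · exact (hl o ho).1
      · exact (hl' o ho).1) _ (List.mem_map_of_mem ho)⟩
  have ha : a ∈ l := h.mem_iff.2 (by simp)
  have ha' : a' ∈ l' := h'.mem_iff.2 (by simp)
  have hb0 : 0 ≤ b := (hl a ha).1.trans (hb a (List.mem_append_left _ ha))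
  have hbl := fun o ho => hb o (List.mem_append_left l' ho)
  have hbl' := fun o ho => hb o (List.mem_append_right l ho)
  have i₁ := (antitone_bernoulliCapped_massesAbove K hl).intervalIntegrable
    (μ := MeasureTheory.volume) (a := 0) (b := b)
  have i₂ := (antitone_bernoulliCapped_massesAbove K hl').intervalIntegrable
    (μ := MeasureTheory.volume) (a := 0) (b := b)
  obtain ⟨j₁, e₁⟩ := integral_sum_massesAbove hl hbl
  obtain ⟨j₂, e₂⟩ := integral_sum_massesAbove hl' hbl'
  rw [listRevenue_eq_integral K hl hbl hs, listRevenue_eq_integral K hl' hbl' hs', ← e₁, ← e₂,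
    ← intervalIntegral.integral_const_mul, ← intervalIntegral.integral_const_mul,
    ← intervalIntegral.integral_const_mul, ← intervalIntegral.integral_const_mul,
    ← intervalIntegral.integral_add (j₁.const_mul _) (j₂.const_mul _),
    ← intervalIntegral.integral_add (i₁.const_mul _) (i₂.const_mul _),
    ← intervalIntegral.integral_const_mul]
  refine intervalIntegral.integral_mono hb0 (((j₁.const_mul _).add (j₂.const_mul _)).const_mul _)
    ((i₁.const_mul _).add (i₂.const_mul _)) fun θ => ?_
  have p₁ : (massesAbove θ l).Perm ((if θ ≤ a.1 then a.2 else 0) :: massesAbove θ r) := h.map _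
  have p₂ : (massesAbove θ l').Perm ((if θ ≤ a'.1 then a'.2 else 0) :: massesAbove θ r) := h'.map _
  have m₁ : ∀ {l : List (ℝ × ℝ)}, IsOfferList l → (massesAbove θ l).sum ≤ (l.map Prod.snd).sum := by
    intro l hl
    refine List.sum_le_sum fun o ho => ?_
    have := hl o ho
    split_ifs
    · rfl
    · exact this.2.1
  have hlt := m₁ hl
  have hlt' := m₁ hl'
  have q₁ := hl.massesAbove θ
  have q₂ := hl'.massesAbove θ
  simp only [p₁.mem_iff] at q₁
  simp only [p₂.mem_iff] at q₂
  simp only [bernoulliCapped_perm K p₁, bernoulliCapped_perm K p₂]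
  simp only [p₁.sum_eq] at hlt ⊢
  simp only [p₂.sum_eq] at hlt' ⊢
  generalize (if θ ≤ a.1 then a.2 else 0) = x at *
  generalize (if θ ≤ a'.1 then a'.2 else 0) = y at *
  generalize massesAbove θ r = m at *
  have hx := q₁ x (by simp)
  have hy := q₂ y (by simp)
  have hmix : (1 - t) * bernoulliCapped K (x :: m) + t * bernoulliCapped K (y :: m) =
      bernoulliCapped K (((1 - t) * x + t * y) :: m) := by
    obtain ⟨k, rfl⟩ := Nat.exists_eq_add_of_le' hK
    simp only [bernoulliCapped]
    ring
  have hsum : (1 - t) * (x :: m).sum + t * (y :: m).sum = (((1 - t) * x + t * y) :: m).sum := by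
    simp only [List.sum_cons]
    ring
  rw [hmix, hsum]
  refine guarantee_mul_sum_le hK (fun q hq => ?_) ?_
  · rcases List.mem_cons.1 hq with rfl | hq
    · constructor <;> nlinarith
    · exact q₁ q (by simp [hq])
  · rw [← hsum]
    nlinarith

/-! ### Expected revenue of decision trees -/

namespace Market

variable {n : ℕ}

/-- The probability that buyer `i` accepts the price `p`. -/
noncomputable def accept (M : Market ℝ n) (i : Fin n) (p : ℝ) : ℝ :=
  ∑ j, if p ≤ M.value i j then M.prob i j else 0

theorem accept_nonneg (M : Market ℝ n) (i : Fin n) (p : ℝ) : 0 ≤ M.accept i p :=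
  Finset.sum_nonneg fun j _ => by
    split_ifs
    · exact (M.prob_pos i j).le
    · rfl

theorem accept_le_one (M : Market ℝ n) (i : Fin n) (p : ℝ) : M.accept i p ≤ 1 := by
  rw [← M.sum_prob i]
  refine Finset.sum_le_sum fun j _ => ?_
  split_ifs
  · rfl
  · exact (M.prob_pos i j).le

/-- A function of the value of buyer `i` and a function of the other values are uncorrelated. -/
theorem expect_mul (M : Market ℝ n) (i : Fin n) (c : ℝ → ℝ) {f : (Fin n → ℝ) → ℝ}
    (hf : ∀ v w, (∀ j, j ≠ i → v j = w j) → f v = f w) :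
    M.expect (fun v => c (v i) * f v) =
      (∑ j, M.prob i j * c (M.value i j)) * M.expect f := by
  let e := Equiv.piSplitAt i fun i => Fin (M.card i)
  have split : ∀ g : (Fin n → ℝ) → ℝ, M.expect g = ∑ a, ∑ r, M.prob i a *
      ((∏ j : {j // j ≠ i}, M.prob j (r j)) * g fun j => M.value j (e.symm (a, r) j)) := by
    intro g
    rw [expect, ← e.symm.sum_comp, Fintype.sum_prod_type]
    refine Finset.sum_congr rfl fun a _ => Finset.sum_congr rfl fun r _ => ?_
    have h : ∏ j, M.prob j (e.symm (a, r) j) =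
        M.prob i a * ∏ j : {j // j ≠ i}, M.prob j (r j) := by
      rw [Fintype.prod_eq_mul_prod_subtype_ne (fun j => M.prob j (e.symm (a, r) j)) i]
      congr 1
      · simp [e, Equiv.piSplitAt]
      · refine Finset.prod_congr rfl fun j _ => ?_
        simp [e, Equiv.piSplitAt, j.2]
    rw [h, mul_assoc]
  have hi : ∀ a r, e.symm (a, r) i = a := fun a r => by simp [e, Equiv.piSplitAt]
  have hfe : ∀ a b r, f (fun j => M.value j (e.symm (a, r) j)) =
      f fun j => M.value j (e.symm (b, r) j) := by
    intro a b r
    refine hf _ _ fun j hj => ?_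
    simp [e, Equiv.piSplitAt, hj]
  rw [split, split, Finset.sum_mul]
  refine Finset.sum_congr rfl fun b _ => ?_
  rw [Finset.sum_comm (s := Finset.univ (α := Fin (M.card i))), Finset.mul_sum]
  refine Finset.sum_congr rfl fun r _ => ?_
  rw [Finset.sum_congr rfl fun a _ => by rw [hfe a b r], ← Finset.sum_mul, M.sum_prob]
  simp only [hi]
  ring

theorem expect_add (M : Market ℝ n) (f g : (Fin n → ℝ) → ℝ) :
    M.expect (fun v => f v + g v) = M.expect f + M.expect g := by
  simp only [expect, mul_add, Finset.sum_add_distrib]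

theorem expect_const (M : Market ℝ n) (c : ℝ) : M.expect (fun _ => c) = c := by
  have h : ∑ ω : (i : Fin n) → Fin (M.card i), ∏ i, M.prob i (ω i) = 1 := by
    have := Finset.prod_univ_sum (fun i => (Finset.univ : Finset (Fin (M.card i))))
      fun i j => M.prob i j
    rw [Fintype.piFinset_univ] at this
    simp [← this, M.sum_prob]
  rw [expect, ← Finset.sum_mul, h, one_mul]

end Market

namespace DecisionTree

variable {n : ℕ}

theorem revenue_congr {T : DecisionTree n} {k : ℕ} {S : Finset (Fin n)} (hT : T.IsMechanism k S)
    {v w : Fin n → ℝ} (h : ∀ j ∈ S, v j = w j) : T.revenue v = T.revenue w := by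
  induction T generalizing k S with
  | halted => rfl
  | offer i p a b iha ihb =>
    obtain ⟨-, hi, -, ha, hb⟩ := hT
    have h' : ∀ j ∈ S.erase i, v j = w j := fun j hj => h j (Finset.mem_of_mem_erase hj)
    rw [revenue, revenue, h i hi, iha ha h', ihb hb h']

theorem expect_offer (M : Market ℝ n) {i : Fin n} {p : ℝ} {a b : DecisionTree n} {k : ℕ}
    {S : Finset (Fin n)} (hT : (offer i p a b).IsMechanism k S) :
    M.expect (offer i p a b).revenue =
      M.accept i p * (p + M.expect a.revenue) + (1 - M.accept i p) * M.expect b.revenue := by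
  obtain ⟨-, -, -, ha, hb⟩ := hT
  have hstep : (offer i p a b).revenue = fun v =>
      (if p ≤ v i then 1 else 0) * (p + a.revenue v) +
        (if p ≤ v i then 0 else 1) * b.revenue v := by
    funext v
    rw [revenue]
    split_ifs <;> ring
  have hne : ∀ v w : Fin n → ℝ, (∀ j, j ≠ i → v j = w j) → ∀ j ∈ S.erase i, v j = w j :=
    fun v w h j hj => h j (Finset.ne_of_mem_erase hj)
  rw [hstep, M.expect_add, M.expect_mul i (fun x => if p ≤ x then 1 else 0)
      fun v w h => by rw [revenue_congr ha (hne v w h)],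
    M.expect_mul i (fun x => if p ≤ x then 0 else 1) fun v w h => revenue_congr hb (hne v w h),
    M.expect_add, M.expect_const]
  congr 2
  · simp [Market.accept]
  · conv_rhs => rw [← M.sum_prob i]
    rw [Market.accept, ← Finset.sum_sub_distrib]
    refine Finset.sum_congr rfl fun j _ => ?_
    split_ifs <;> ring

/-- Lagrangian bound: if every copy is charged `lam`, then buyer `i` contributes at most `m i`. -/
theorem expect_revenue_le (M : Market ℝ n) {lam : ℝ} (hlam : 0 ≤ lam) {m : Fin n → ℝ}
    (hm : ∀ i, 0 ≤ m i) (hm' : ∀ i p, 0 ≤ p → (p - lam) * M.accept i p ≤ m i)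
    {T : DecisionTree n} {k : ℕ} {S : Finset (Fin n)} (hT : T.IsMechanism k S) :
    M.expect T.revenue ≤ k * lam + ∑ i ∈ S, m i := by
  induction T generalizing k S with
  | halted =>
    have : M.expect (halted : DecisionTree n).revenue = 0 := M.expect_const 0
    rw [this]
    have := Finset.sum_nonneg fun i (_ : i ∈ S) => hm i
    positivity
  | offer i p a b iha ihb =>
    rw [expect_offer M hT]
    obtain ⟨hk, hi, hp, ha, hb⟩ := hT
    have h₁ := iha ha
    have h₂ := ihb hb
    have h₃ := hm' i p hp
    have h₄ := M.accept_nonneg i p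
    have h₅ := M.accept_le_one i p
    obtain ⟨k, rfl⟩ := Nat.exists_eq_add_of_le' (Nat.one_le_iff_ne_zero.2 hk.ne')
    rw [← Finset.add_sum_erase S m hi]
    rw [Nat.add_sub_cancel] at h₁
    push_cast at h₂ ⊢
    generalize ∑ x ∈ S.erase i, m x = s at *
    nlinarith [mul_le_mul_of_nonneg_left h₁ h₄,
      mul_le_mul_of_nonneg_left h₂ (sub_nonneg.2 h₅)]

theorem expect_revenue_ofList (M : Market ℝ n) (l : List (Fin n × ℝ)) (k : ℕ)
    (hnd : (l.map Prod.fst).Nodup) (hp : ∀ x ∈ l, 0 ≤ x.2) :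
    M.expect (ofList k l).revenue = listRevenue k (l.map fun o => (o.2, M.accept o.1 o.2)) := by
  induction l generalizing k with
  | nil => cases k <;> exact M.expect_const 0
  | cons o l ih =>
    cases k with
    | zero => exact M.expect_const 0
    | succ k =>
      have h := ofList_isMechanism (o :: l) (k + 1) hnd hp
      rw [List.map_cons, List.nodup_cons] at hnd
      have hp' : ∀ x ∈ l, 0 ≤ x.2 := fun x hx => hp x (by simp [hx])
      obtain ⟨i, p⟩ := o
      rw [ofList] at h ⊢
      rw [expect_offer M h, ih k hnd.2 hp', ih (k + 1) hnd.2 hp']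
      rfl

end DecisionTree

theorem SPM.expectedRevenue_eq {n : ℕ} (S : SPM ℝ n) (K : ℕ) (M : Market ℝ n) :
    S.expectedRevenue K M =
      listRevenue K (S.offers.map fun o => (o.2, M.accept o.1 o.2)) := by
  refine DecisionTree.expect_revenue_ofList M S.offers K ?_ fun x hx => ?_
  · rw [S.map_fst_offers]
    exact List.nodup_ofFn.2 S.order.injective
  · obtain ⟨t, rfl⟩ := (List.mem_ofFn' _ _).1 hx
    exact S.price_nonneg _

/-- Every order of the buyers and all prices come from a mechanism. -/
theorem exists_spm_offers {F : Type} [Field F] [LinearOrder F] {n : ℕ} {l : List (Fin n)}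
    (hl : l.Perm (List.finRange n)) {price : Fin n → F} (hp : ∀ i, 0 ≤ price i) :
    ∃ S : SPM F n, S.price = price ∧ S.offers = l.map fun i => (i, price i) := by
  have hlen : l.length = n := by rw [hl.length_eq, List.length_finRange]
  have hnd : l.Nodup := hl.nodup_iff.2 (List.nodup_finRange n)
  have hmem : ∀ i, i ∈ l := fun i => hl.mem_iff.2 (List.mem_finRange i)
  let e : Equiv.Perm (Fin n) := (finCongr hlen.symm).trans (hnd.getEquivOfForallMemList l hmem)
  refine ⟨⟨e, price, hp⟩, rfl, List.ext_getElem (by simp [SPM.offers, hlen]) fun t h₁ h₂ => ?_⟩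
  simp [SPM.offers, e, List.Nodup.getEquivOfForallMemList]

/-! ### Choices of prices and their Lagrangian optimality -/

namespace Market

variable {n : ℕ}

/-- The price of an option of buyer `i`: one of the buyer's values, or no offer. -/
def optionPrice (M : Market ℝ n) (i : Fin n) : Option (Fin (M.card i)) → ℝ
  | none => 0
  | some j => M.value i j

/-- The probability of a sale for an option of buyer `i`. -/
noncomputable def optionMass (M : Market ℝ n) (i : Fin n) : Option (Fin (M.card i)) → ℝ
  | none => 0
  | some j => M.accept i (M.value i j)

/-- The expected payment for an option of buyer `i`. -/
noncomputable def optionRevenue (M : Market ℝ n) (i : Fin n) (o : Option (Fin (M.card i))) : ℝ :=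
  M.optionPrice i o * M.optionMass i o

/-- A choice of an option for every buyer. -/
abbrev Choice (M : Market ℝ n) : Type := (i : Fin n) → Option (Fin (M.card i))

/-- The expected number of sales with unlimited supply. -/
noncomputable def mass (M : Market ℝ n) (c : M.Choice) : ℝ := ∑ i, M.optionMass i (c i)

/-- The choice maximizes the expected revenue with unlimited supply at a cost of `lam` per copy. -/
def IsOptimal (M : Market ℝ n) (lam : ℝ) (c : M.Choice) : Prop :=
  ∀ i o, M.optionRevenue i o - lam * M.optionMass i o ≤
    M.optionRevenue i (c i) - lam * M.optionMass i (c i)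

/-- Option `o` of buyer `i` is sold more often than the chosen option and has larger revenue. -/
def Improves (M : Market ℝ n) (c : M.Choice) (i : Fin n) (o : Option (Fin (M.card i))) : Prop :=
  M.optionMass i (c i) < M.optionMass i o ∧ M.optionRevenue i (c i) < M.optionRevenue i o

/-- Revenue gained per additional sale when option `o` replaces the choice for buyer `i`. -/
noncomputable def slope (M : Market ℝ n) (c : M.Choice) (i : Fin n)
    (o : Option (Fin (M.card i))) : ℝ :=
  (M.optionRevenue i o - M.optionRevenue i (c i)) / (M.optionMass i o - M.optionMass i (c i))

variable (M : Market ℝ n)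

theorem optionPrice_nonneg (i : Fin n) (o : Option (Fin (M.card i))) : 0 ≤ M.optionPrice i o := by
  cases o
  · exact le_rfl
  · exact M.value_nonneg i _

theorem optionMass_nonneg (i : Fin n) (o : Option (Fin (M.card i))) : 0 ≤ M.optionMass i o := by
  cases o
  · exact le_rfl
  · exact M.accept_nonneg i _

theorem optionMass_le_accept (i : Fin n) (o : Option (Fin (M.card i))) :
    M.optionMass i o ≤ M.accept i (M.optionPrice i o) := by
  cases o
  · exact M.accept_nonneg i _
  · exact le_rfl

variable {M}

/-- Prices other than the values of a buyer do not increase the Lagrangian. -/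
theorem IsOptimal.mul_accept_le {lam : ℝ} {c : M.Choice} (hc : M.IsOptimal lam c) (i : Fin n)
    (p : ℝ) : (p - lam) * M.accept i p ≤
      M.optionRevenue i (c i) - lam * M.optionMass i (c i) := by
  have h0 : 0 ≤ M.optionRevenue i (c i) - lam * M.optionMass i (c i) := by
    simpa [optionRevenue, optionPrice, optionMass] using hc i none
  by_cases hp : ∃ j, p ≤ M.value i j
  · -- The smallest value that is at least `p` is accepted equally often.
    obtain ⟨j, hj, hmin⟩ := (Finset.univ.filter fun j => p ≤ M.value i j).exists_min_image
      (M.value i) (by simpa [Finset.Nonempty] using hp)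
    have hj' : p ≤ M.value i j := by simpa using hj
    have hq : M.accept i p = M.accept i (M.value i j) := by
      refine Finset.sum_congr rfl fun k _ => ?_
      by_cases hk : p ≤ M.value i k
      · rw [if_pos hk, if_pos (hmin k (by simpa using hk))]
      · rw [if_neg hk, if_neg fun h => hk (hj'.trans h)]
    have : M.value i j * M.accept i (M.value i j) - lam * M.accept i (M.value i j) ≤ _ :=
      hc i (some j)
    rw [hq]
    nlinarith [M.accept_nonneg i (M.value i j)]
  · have hq : M.accept i p = 0 :=
      Finset.sum_eq_zero fun j _ => if_neg fun h => hp ⟨j, h⟩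
    rw [hq, mul_zero]
    exact h0

theorem IsOptimal.expectedRevenue_le {lam : ℝ} (hlam : 0 ≤ lam) {c : M.Choice}
    (hc : M.IsOptimal lam c) {K : ℕ} (A : ASPM n K) :
    A.expectedRevenue M ≤ ∑ i, M.optionRevenue i (c i) + lam * (K - M.mass c) := by
  refine (DecisionTree.expect_revenue_le M hlam
    (m := fun i => M.optionRevenue i (c i) - lam * M.optionMass i (c i)) (fun i => ?_)
    (fun i p _ => hc.mul_accept_le i p) A.isMechanism).trans_eq ?_
  · simpa [optionRevenue, optionPrice, optionMass] using hc i none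
  · rw [Finset.sum_sub_distrib, ← Finset.mul_sum, mass]
    ring

/-- Lowering the cost per copy keeps a choice optimal until some replacement pays off. -/
theorem IsOptimal.of_le {lam lam' : ℝ} {c : M.Choice} (hc : M.IsOptimal lam c) (h0 : 0 ≤ lam')
    (hle : lam' ≤ lam) (h : ∀ i o, M.Improves c i o → M.slope c i o ≤ lam') :
    M.IsOptimal lam' c := by
  intro i o
  rcases le_or_gt (M.optionMass i o) (M.optionMass i (c i)) with hm | hm
  · have := hc i o
    nlinarith
  · rcases le_or_gt (M.optionRevenue i o) (M.optionRevenue i (c i)) with hr | hr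
    · nlinarith
    · have := h i o ⟨hm, hr⟩
      rw [slope, div_le_iff₀ (sub_pos.2 hm)] at this
      linarith

theorem Improves.slope_pos {c : M.Choice} {i : Fin n} {o : Option (Fin (M.card i))}
    (h : M.Improves c i o) : 0 < M.slope c i o :=
  div_pos (sub_pos.2 h.2) (sub_pos.2 h.1)

theorem IsOptimal.zero {lam : ℝ} (hlam : 0 ≤ lam) {c : M.Choice} (hc : M.IsOptimal lam c)
    (h : ∀ i o, ¬ M.Improves c i o) : M.IsOptimal 0 c :=
  hc.of_le le_rfl hlam fun i o ho => absurd ho (h i o)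

/-- At its slope, the best improvement leads from an optimal choice to an optimal choice. -/
theorem IsOptimal.update {lam : ℝ} {c : M.Choice} (hc : M.IsOptimal lam c) {i : Fin n}
    {o : Option (Fin (M.card i))} (ho : M.Improves c i o)
    (hmax : ∀ i' o', M.Improves c i' o' → M.slope c i' o' ≤ M.slope c i o) :
    M.IsOptimal (M.slope c i o) c ∧ M.IsOptimal (M.slope c i o) (Function.update c i o) := by
  have hd := sub_pos.2 ho.1
  have hle : M.slope c i o ≤ lam := by
    rw [slope, div_le_iff₀ hd]
    linarith [hc i o]
  have h₁ := hc.of_le ho.slope_pos.le hle hmax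
  refine ⟨h₁, fun i' o' => ?_⟩
  by_cases hi : i' = i
  · subst hi
    rw [Function.update_self]
    have h₂ := h₁ i' o'
    have h₃ : M.slope c i' o * (M.optionMass i' o - M.optionMass i' (c i')) =
        M.optionRevenue i' o - M.optionRevenue i' (c i') := div_mul_cancel₀ _ hd.ne'
    linarith
  · rw [Function.update_of_ne hi]
    exact h₁ i' o'

/-- If copies are expensive, it is optimal to serve nobody. -/
theorem exists_isOptimal_none (M : Market ℝ n) :
    ∃ lam, 0 ≤ lam ∧ M.IsOptimal lam fun _ => none := by
  refine ⟨∑ i, ∑ j, M.value i j, Finset.sum_nonneg fun i _ => Finset.sum_nonneg fun j _ =>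
    M.value_nonneg i j, fun i o => ?_⟩
  have h : M.optionPrice i o ≤ ∑ i, ∑ j, M.value i j := by
    cases o with
    | none => exact Finset.sum_nonneg fun i _ => Finset.sum_nonneg fun j _ => M.value_nonneg i j
    | some j =>
      exact (Finset.single_le_sum (fun j _ => M.value_nonneg i j) (Finset.mem_univ j)).trans
        (Finset.single_le_sum (f := fun i => ∑ j, M.value i j)
          (fun i _ => Finset.sum_nonneg fun j _ => M.value_nonneg i j) (Finset.mem_univ i))
  have := mul_le_mul_of_nonneg_right h (M.optionMass_nonneg i o)
  simpa [optionRevenue, optionPrice, optionMass] using this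

/-! ### Revenue of sequential posted prices -/

variable (M) in
/-- The offers of a choice to the buyers in a given order, with their probabilities of a sale. -/
noncomputable def choiceOffers (c : M.Choice) (l : List (Fin n)) : List (ℝ × ℝ) :=
  l.map fun i => (M.optionPrice i (c i), M.optionMass i (c i))

variable (M) in
/-- The buyers are ordered by decreasing price. -/
structure Sorted (c : M.Choice) (l : List (Fin n)) : Prop where
  perm : l.Perm (List.finRange n)
  pairwise : l.Pairwise fun i j => M.optionPrice j (c j) ≤ M.optionPrice i (c i)

theorem isOfferList_choiceOffers (c : M.Choice) (l : List (Fin n)) :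
    IsOfferList (M.choiceOffers c l) := by
  intro x hx
  obtain ⟨i, -, rfl⟩ := List.mem_map.1 hx
  exact ⟨M.optionPrice_nonneg i _, M.optionMass_nonneg i _,
    (M.optionMass_le_accept i _).trans (M.accept_le_one i _)⟩

theorem Sorted.choiceOffers {c : M.Choice} {l : List (Fin n)} (h : M.Sorted c l) :
    (M.choiceOffers c l).Pairwise fun o o' => o'.1 ≤ o.1 :=
  List.pairwise_map.2 h.pairwise

theorem Sorted.sum {c : M.Choice} {l : List (Fin n)} (h : M.Sorted c l) (f : Fin n → ℝ) :
    (l.map f).sum = ∑ i, f i := by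
  rw [(h.perm.map f).sum_eq, ← List.ofFn_eq_map, List.sum_ofFn]

theorem exists_sorted (c : M.Choice) : ∃ l, M.Sorted c l := by
  let r : Fin n → Fin n → Prop := fun i j => M.optionPrice j (c j) ≤ M.optionPrice i (c i)
  have : Std.Total r := ⟨fun i j => le_total _ _⟩
  have : IsTrans (Fin n) r := ⟨fun i j k h₁ h₂ => le_trans h₂ h₁⟩
  classical
  exact ⟨(List.finRange n).insertionSort r, List.perm_insertionSort r _,
    List.pairwise_insertionSort r _⟩

/-- Buyers without an offer in the choice get one in the mechanism; this does no harm, since the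
mechanism makes them last and at price `0`. -/
theorem Sorted.listRevenue_le {c : M.Choice} {l : List (Fin n)} (h : M.Sorted c l) (K : ℕ)
    {S : SPM ℝ n} (hS : S.offers = l.map fun i => (i, M.optionPrice i (c i))) :
    listRevenue K (M.choiceOffers c l) ≤ S.expectedRevenue K M := by
  rw [S.expectedRevenue_eq, hS, List.map_map]
  refine listRevenue_mono K (isOfferList_choiceOffers c l) ?_ ?_ h.choiceOffers
    (List.pairwise_map.2 h.pairwise)
  · intro x hx
    obtain ⟨i, -, rfl⟩ := List.mem_map.1 hx
    exact ⟨M.optionPrice_nonneg i _, M.accept_nonneg i _, M.accept_le_one i _⟩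
  · rw [Market.choiceOffers, List.forall₂_map_left_iff, List.forall₂_map_right_iff,
      List.forall₂_same]
    exact fun i _ => ⟨rfl, M.optionMass_le_accept i _⟩

theorem choiceOffers_perm_cons {c : M.Choice} {l : List (Fin n)} (h : M.Sorted c l) (i : Fin n) :
    (M.choiceOffers c l).Perm ((M.optionPrice i (c i), M.optionMass i (c i)) ::
      M.choiceOffers c ((List.finRange n).erase i)) :=
  (h.perm.trans (List.perm_cons_erase (List.mem_finRange i))).map _

/-- A choice that is optimal without costs and does not exceed the supply on average. -/
theorem IsOptimal.guarantee_mul_le {K : ℕ} (hK : 1 ≤ K) {c : M.Choice} (hc : M.IsOptimal 0 c)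
    (hm : M.mass c ≤ K) {l : List (Fin n)} (h : M.Sorted c l) (A : ASPM n K) :
    guarantee K * A.expectedRevenue M ≤ listRevenue K (M.choiceOffers c l) := by
  have hA := hc.expectedRevenue_le le_rfl A
  rw [zero_mul, add_zero] at hA
  refine (mul_le_mul_of_nonneg_left hA (guarantee_pos hK).le).trans ?_
  cases n with
  | zero =>
    have hl : l = [] := List.eq_nil_of_length_eq_zero (by rw [h.perm.length_eq]; simp)
    obtain ⟨k, rfl⟩ := Nat.exists_eq_add_of_le' hK
    simp [hl, choiceOffers, listRevenue]
  | succ n =>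
    have hp := choiceOffers_perm_cons h 0
    have := guarantee_mul_mixture_le hK (isOfferList_choiceOffers c l)
      (isOfferList_choiceOffers c l) h.choiceOffers h.choiceOffers hp hp (t := 0) le_rfl
      zero_le_one (by
        rw [Market.choiceOffers, List.map_map, h.sum]
        simpa [mass, Function.comp_def] using hm)
    simp only [sub_zero, one_mul, zero_mul, add_zero] at this
    refine le_trans (le_of_eq ?_) this
    rw [Market.choiceOffers, List.map_map, h.sum]
    rfl

/-- Of two choices that are optimal for the same cost, that differ in one buyer, and whose numbers
of sales enclose the supply, the better one is good enough: a mixture of the two sells all copies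
on average, so that its revenue with unlimited supply is that of the Lagrangian bound. -/
theorem IsOptimal.guarantee_mul_le_max {K : ℕ} (hK : 1 ≤ K) {lam : ℝ} (hlam : 0 ≤ lam)
    {c : M.Choice} {i : Fin n} {o : Option (Fin (M.card i))} (hc : M.IsOptimal lam c)
    (hc' : M.IsOptimal lam (Function.update c i o)) (hm : M.mass c ≤ K)
    (hm' : K < M.mass (Function.update c i o)) {l l' : List (Fin n)} (h : M.Sorted c l)
    (h' : M.Sorted (Function.update c i o) l') (A : ASPM n K) :
    guarantee K * A.expectedRevenue M ≤ max (listRevenue K (M.choiceOffers c l))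
      (listRevenue K (M.choiceOffers (Function.update c i o) l')) := by
  set c' := Function.update c i o with hcc
  have hd : 0 < M.mass c' - M.mass c := by linarith
  obtain ⟨t, ht, ht', hmix⟩ : ∃ t : ℝ, 0 ≤ t ∧ t ≤ 1 ∧ (1 - t) * M.mass c + t * M.mass c' = K := by
    refine ⟨(K - M.mass c) / (M.mass c' - M.mass c), div_nonneg (by linarith) hd.le,
      (div_le_one hd).2 (by linarith), ?_⟩
    field_simp
    ring
  have hp := choiceOffers_perm_cons h i
  have hp' : (M.choiceOffers c' l').Perm ((M.optionPrice i (c' i), M.optionMass i (c' i)) ::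
      M.choiceOffers c ((List.finRange n).erase i)) := by
    have := choiceOffers_perm_cons h' i
    have e : M.choiceOffers c' ((List.finRange n).erase i) =
        M.choiceOffers c ((List.finRange n).erase i) := by
      refine List.map_congr_left fun j hj => ?_
      have hj : j ≠ i := fun e => (List.nodup_finRange n).not_mem_erase (e ▸ hj)
      rw [hcc, Function.update_of_ne hj]
    rwa [e] at this
  have hsum : ∀ {c : M.Choice} {l : List (Fin n)}, M.Sorted c l →
      ((M.choiceOffers c l).map Prod.snd).sum = M.mass c ∧
      ((M.choiceOffers c l).map fun o => o.1 * o.2).sum = ∑ i, M.optionRevenue i (c i) := by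
    intro c l h
    rw [Market.choiceOffers, List.map_map, List.map_map, h.sum, h.sum]
    exact ⟨rfl, rfl⟩
  have main := guarantee_mul_mixture_le hK (isOfferList_choiceOffers c l)
    (isOfferList_choiceOffers c' l') h.choiceOffers h'.choiceOffers hp hp' ht ht'
    (by rw [(hsum h).1, (hsum h').1, hmix])
  rw [(hsum h).2, (hsum h').2] at main
  have hA := hc.expectedRevenue_le hlam A
  have hA' := hc'.expectedRevenue_le hlam A
  have hAmix : A.expectedRevenue M ≤ (1 - t) * ∑ i, M.optionRevenue i (c i) +
      t * ∑ i, M.optionRevenue i (c' i) := by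
    have h₁ := mul_le_mul_of_nonneg_left hA (sub_nonneg.2 ht')
    have h₂ := mul_le_mul_of_nonneg_left hA' ht
    have h₃ : lam * ((1 - t) * M.mass c + t * M.mass c' - K) = 0 := by rw [hmix]; ring
    linarith
  refine (mul_le_mul_of_nonneg_left hAmix (guarantee_pos hK).le).trans (main.trans ?_)
  have h₁ := mul_le_mul_of_nonneg_left
    (le_max_left (listRevenue K (M.choiceOffers c l)) (listRevenue K (M.choiceOffers c' l')))
    (sub_nonneg.2 ht')
  have h₂ := mul_le_mul_of_nonneg_left
    (le_max_right (listRevenue K (M.choiceOffers c l)) (listRevenue K (M.choiceOffers c' l'))) ht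
  linarith

/-- The approximation guarantee for real data. -/
theorem exists_spm_guarantee {K : ℕ} (hK : 1 ≤ K) (M : Market ℝ n) :
    ∃ S : SPM ℝ n, ∀ A : ASPM n K,
      guarantee K * A.expectedRevenue M ≤ S.expectedRevenue K M := by
  classical
  have mech : ∀ c : M.Choice, ∃ l, M.Sorted c l ∧ ∃ S : SPM ℝ n,
      listRevenue K (M.choiceOffers c l) ≤ S.expectedRevenue K M := by
    intro c
    obtain ⟨l, hl⟩ := exists_sorted c
    obtain ⟨S, -, hS⟩ := exists_spm_offers hl.perm fun i => M.optionPrice_nonneg i (c i)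
    exact ⟨l, hl, S, hl.listRevenue_le K hS⟩
  obtain ⟨c, hc, hmax⟩ := (Finset.univ.filter fun c : M.Choice =>
    M.mass c ≤ K ∧ ∃ lam, 0 ≤ lam ∧ M.IsOptimal lam c).exists_max_image M.mass
    ⟨fun _ => none, by
      rw [Finset.mem_filter]
      exact ⟨Finset.mem_univ _, by simp [mass, optionMass], M.exists_isOptimal_none⟩⟩
  obtain ⟨-, hm, lam, hlam, hc⟩ := Finset.mem_filter.1 hc
  obtain ⟨l, hl, S, hS⟩ := mech c
  by_cases hI : ∃ i o, M.Improves c i o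
  · obtain ⟨⟨i, o⟩, ho, hbest⟩ := (Finset.univ.filter
      fun x : (i : Fin n) × Option (Fin (M.card i)) =>
      M.Improves c x.1 x.2).exists_max_image (fun x => M.slope c x.1 x.2)
      (by obtain ⟨i, o, ho⟩ := hI; exact ⟨⟨i, o⟩, by simpa using ho⟩)
    have ho' : M.Improves c i o := by simpa using ho
    obtain ⟨h₁, h₂⟩ := hc.update ho' fun i' o' h => hbest ⟨i', o'⟩ (by simpa using h)
    have hm' : K < M.mass (Function.update c i o) := by
      by_contra hcon
      have := hmax (Function.update c i o)
        (Finset.mem_filter.2 ⟨Finset.mem_univ _, not_lt.1 hcon, _, ho'.slope_pos.le, h₂⟩)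
      refine absurd this (not_le.2 (Finset.sum_lt_sum (fun j _ => ?_) ⟨i, Finset.mem_univ i, ?_⟩))
      · by_cases hj : j = i
        · subst hj
          rw [Function.update_self]
          exact ho'.1.le
        · rw [Function.update_of_ne hj]
      · rw [Function.update_self]
        exact ho'.1
    obtain ⟨l', hl', S', hS'⟩ := mech (Function.update c i o)
    have key := h₁.guarantee_mul_le_max hK ho'.slope_pos.le h₂ hm hm' hl hl'
    rcases le_total (S.expectedRevenue K M) (S'.expectedRevenue K M) with h | h
    · exact ⟨S', fun A => (key A).trans (max_le (hS.trans h) hS')⟩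
    · exact ⟨S, fun A => (key A).trans (max_le hS (hS'.trans h))⟩
  · have h₀ := hc.zero hlam fun i o ho => hI ⟨i, o, ho⟩
    exact ⟨S, fun A => (h₀.guarantee_mul_le hK hm hl A).trans hS⟩

end Market

/-! ### Rational markets as inputs of the algorithm -/

/-- A rational number as numerator and denominator. -/
def ratPair (q : ℚ) : ℕ × ℕ := (q.num.toNat, q.den)

namespace Market

variable {n : ℕ} (M : Market ℚ n)

/-- The distribution of buyer `i` in the form of the input. -/
def entries (i : Fin n) : List Entry :=
  List.ofFn fun j : Fin (M.card i) => (ratPair (M.value i j), ratPair (M.prob i j))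

/-- All distributions in the form of the input. -/
def inputList : List (List Entry) := List.ofFn M.entries

theorem code_inputList (K : ℕ) : code (K, M.inputList) = encodeInput K M := by
  change Data.pair _ (Data.ofList _) = Data.pair _ (Data.ofList _)
  rw [inputList, List.map_ofFn]
  congr 3
  funext i
  change Data.ofList _ = Data.ofList _
  rw [entries, List.map_ofFn]
  rfl

/-- The common denominator that the algorithm uses. -/
def den : ℕ := commonDen M.inputList

variable {M}

theorem den_dvd (i : Fin n) (j : Fin (M.card i)) :
    (M.value i j).den * (M.prob i j).den ∣ M.den := by
  refine dvd_trans ?_ (List.dvd_prod (List.mem_map_of_mem (List.mem_ofFn.2 ⟨i, rfl⟩)))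
  exact List.dvd_prod (List.mem_map.2 ⟨_, List.mem_ofFn.2 ⟨j, rfl⟩, rfl⟩)

variable (M) in
theorem den_pos : 0 < M.den := by
  refine Nat.pos_of_ne_zero (List.prod_ne_zero fun h => ?_)
  obtain ⟨l, hl, h⟩ := List.mem_map.1 h
  obtain ⟨i, rfl⟩ := List.mem_ofFn.1 hl
  refine List.prod_ne_zero (fun h => ?_) h
  obtain ⟨e, he, h⟩ := List.mem_map.1 h
  obtain ⟨j, rfl⟩ := List.mem_ofFn.1 he
  exact mul_ne_zero (M.value i j).den_nz (M.prob i j).den_nz h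

end Market

theorem cast_scaled {D : ℕ} {q : ℚ} (hq : 0 ≤ q) (hD : q.den ∣ D) :
    (scaled D (ratPair q) : ℝ) = D * (q : ℝ) := by
  obtain ⟨m, rfl⟩ := hD
  have h : ((q.num.toNat : ℕ) : ℝ) = q.den * (q : ℝ) := by
    have h₁ : ((q.num.toNat : ℕ) : ℤ) = q.num := Int.toNat_of_nonneg (Rat.num_nonneg.2 hq)
    have h₂ : ((q.num.toNat : ℕ) : ℚ) = q.den * q := by
      rw [mul_comm, Rat.mul_den_eq_num]
      exact_mod_cast h₁
    exact_mod_cast h₂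
  rw [scaled, ratPair, Nat.mul_div_cancel_left m q.den_pos, Nat.cast_mul, h, Nat.cast_mul]
  ring

theorem sum_map_filter {α : Type} (p : α → Bool) (f : α → ℕ) (l : List α) :
    ((l.filter p).map f).sum = (l.map fun x => if p x = true then f x else 0).sum := by
  induction l with
  | nil => rfl
  | cons a l ih => cases h : p a <;> simp [h, ih]

namespace Market

variable {n : ℕ} {M : Market ℚ n}

theorem cast_scaled_value (i : Fin n) (j : Fin (M.card i)) :
    (scaled M.den (ratPair (M.value i j)) : ℝ) = M.den * M.toReal.value i j :=
  cast_scaled (M.value_nonneg i j) ((Dvd.intro _ rfl).trans (den_dvd i j))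

theorem cast_scaled_prob (i : Fin n) (j : Fin (M.card i)) :
    (scaled M.den (ratPair (M.prob i j)) : ℝ) = M.den * M.toReal.prob i j :=
  cast_scaled (M.prob_pos i j).le ((Dvd.intro_left _ rfl).trans (den_dvd i j))

theorem den_pos_real : (0 : ℝ) < M.den := Nat.cast_pos.2 M.den_pos

variable (M) in
/-- An option of buyer `i` as an offer of the algorithm. -/
def offer (i : Fin n) : Option (Fin (M.toReal.card i)) → Offer
  | none => nullOffer i
  | some j => entryOffer M.den (M.entries i) i (ratPair (M.value i j), ratPair (M.prob i j))

theorem offer_buyer (i : Fin n) (o : Option (Fin (M.toReal.card i))) : (M.offer i o).buyer = i := by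
  cases o <;> rfl

theorem cast_offer_cost (i : Fin n) (o : Option (Fin (M.toReal.card i))) :
    ((M.offer i o).cost : ℝ) = M.den * M.toReal.optionPrice i o := by
  cases o with
  | none => simp [offer, nullOffer, optionPrice]
  | some j => exact cast_scaled_value i j

theorem cast_tailMass (i : Fin n) (j : Fin (M.card i)) :
    (tailMass M.den (M.entries i) (ratPair (M.value i j), ratPair (M.prob i j)) : ℝ) =
      M.den * M.toReal.accept i (M.toReal.value i j) := by
  change _ =
    M.den * ∑ k, if M.toReal.value i j ≤ M.toReal.value i k then M.toReal.prob i k else 0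
  rw [tailMass, sum_map_filter, entries, List.map_ofFn, List.sum_ofFn, Nat.cast_sum,
    Finset.mul_sum]
  refine Finset.sum_congr rfl fun k _ => ?_
  have h : scaled M.den (ratPair (M.value i j)) ≤ scaled M.den (ratPair (M.value i k)) ↔
      M.toReal.value i j ≤ M.toReal.value i k := by
    rw [← Nat.cast_le (α := ℝ), cast_scaled_value, cast_scaled_value,
      mul_le_mul_iff_right₀ den_pos_real]
  simp only [Function.comp_apply, decide_eq_true_eq, h]
  split_ifs
  · exact cast_scaled_prob i k
  · simp

theorem cast_offer_mass (i : Fin n) (o : Option (Fin (M.toReal.card i))) :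
    ((M.offer i o).mass : ℝ) = M.den * M.toReal.optionMass i o := by
  cases o with
  | none => simp [offer, nullOffer, optionMass]
  | some j => exact cast_tailMass i j

theorem offer_mass_lt_iff (i : Fin n) (o o' : Option (Fin (M.toReal.card i))) :
    (M.offer i o).mass < (M.offer i o').mass ↔
      M.toReal.optionMass i o < M.toReal.optionMass i o' := by
  rw [← Nat.cast_lt (α := ℝ), cast_offer_mass, cast_offer_mass, mul_lt_mul_iff_right₀ den_pos_real]

theorem cast_offer_revenue (i : Fin n) (o : Option (Fin (M.toReal.card i))) :
    ((M.offer i o).cost : ℝ) * (M.offer i o).mass =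
      M.den ^ 2 * M.toReal.optionRevenue i o := by
  rw [cast_offer_cost, cast_offer_mass, optionRevenue]
  ring

theorem offer_improves_iff (c : M.toReal.Choice) (i : Fin n) (o : Option (Fin (M.toReal.card i))) :
    ((M.offer i (c i)).mass < (M.offer i o).mass ∧
      (M.offer i (c i)).cost * (M.offer i (c i)).mass < (M.offer i o).cost * (M.offer i o).mass) ↔
      M.toReal.Improves c i o := by
  have hD : (0 : ℝ) < M.den ^ 2 := pow_pos den_pos_real 2
  rw [Improves, offer_mass_lt_iff, ← Nat.cast_lt (α := ℝ), Nat.cast_mul, Nat.cast_mul,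
    cast_offer_revenue, cast_offer_revenue, mul_lt_mul_iff_right₀ hD]

variable (M) in
/-- The state of the algorithm that represents a choice. -/
def slots (c : M.toReal.Choice) : List Slot :=
  List.ofFn fun i =>
    (M.offer i (c i), List.ofFn fun j : Fin (M.toReal.card i) => M.offer i (some j))

theorem initialSlots_inputList : initialSlots M.inputList = M.slots fun _ => none := by
  have h : M.inputList.zipIdx = List.ofFn fun i : Fin n => (M.entries i, (i : ℕ)) := by
    refine List.ext_getElem (by simp [inputList]) fun t h₁ h₂ => ?_
    simp [inputList]
  rw [initialSlots, h, List.map_ofFn, slots]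
  congr 1
  funext i
  simp only [Function.comp_apply]
  nth_rewrite 2 [entries]
  rw [List.map_ofFn]
  rfl

theorem cast_slotsMass (c : M.toReal.Choice) :
    (slotsMass (M.slots c) : ℝ) = M.den * M.toReal.mass c := by
  rw [slotsMass, slots, List.map_ofFn, List.sum_ofFn, Nat.cast_sum, mass, Finset.mul_sum]
  exact Finset.sum_congr rfl fun i _ => cast_offer_mass i (c i)

theorem slotsMass_gt_iff (K : ℕ) (c : M.toReal.Choice) :
    K * M.den < slotsMass (M.slots c) ↔ K < M.toReal.mass c := by
  rw [← Nat.cast_lt (α := ℝ), cast_slotsMass, Nat.cast_mul, mul_comm,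
    mul_lt_mul_iff_right₀ den_pos_real]

theorem mem_upgrades_slots {c : M.toReal.Choice} {u : Offer × Offer} :
    u ∈ upgrades (M.slots c) ↔
      ∃ i o, u = (M.offer i (c i), M.offer i o) ∧ M.toReal.Improves c i o := by
  rw [mem_upgrades]
  constructor
  · rintro ⟨x, hx, hu, hmem, h⟩
    obtain ⟨i, rfl⟩ := List.mem_ofFn.1 hx
    obtain ⟨j, hj⟩ := List.mem_ofFn.1 hmem
    obtain ⟨u, w⟩ := u
    simp only at hu hj h
    subst hu hj
    exact ⟨i, some j, rfl, (offer_improves_iff c i _).1 h⟩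
  · rintro ⟨i, o, rfl, h⟩
    cases o with
    | none => exact absurd h.1 (not_lt.2 (M.toReal.optionMass_nonneg i _))
    | some j =>
      exact ⟨_, List.mem_ofFn.2 ⟨i, rfl⟩, rfl, List.mem_ofFn.2 ⟨j, rfl⟩,
        (offer_improves_iff c i _).2 h⟩

theorem switchTo_slots (c : M.toReal.Choice) (i : Fin n) (o : Option (Fin (M.toReal.card i))) :
    switchTo (M.slots c) (M.offer i o) = M.slots (Function.update c i o) := by
  rw [switchTo, slots, List.map_ofFn, slots]
  congr 1
  funext k
  simp only [Function.comp_apply, offer_buyer, Fin.val_inj]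
  by_cases h : k = i
  · subst h
    rw [if_pos rfl, Function.update_self]
  · rw [if_neg h, Function.update_of_ne h]

end Market

/-! ### The greedy algorithm follows optimal choices -/

/-- Revenue gained per mass by an upgrade. -/
noncomputable def upgradeSlope (u : Offer × Offer) : ℝ :=
  ((u.2.cost : ℝ) * u.2.mass - u.1.cost * u.1.mass) / (u.2.mass - u.1.mass)

theorem steeper_iff {u w : Offer × Offer} (hu : u.1.mass < u.2.mass)
    (hu' : u.1.cost * u.1.mass ≤ u.2.cost * u.2.mass) (hw : w.1.mass < w.2.mass)
    (hw' : w.1.cost * w.1.mass ≤ w.2.cost * w.2.mass) :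
    steeper u w = true ↔ upgradeSlope w ≤ upgradeSlope u := by
  rw [upgradeSlope, upgradeSlope, div_le_div_iff₀ (sub_pos.2 (Nat.cast_lt.2 hw))
    (sub_pos.2 (Nat.cast_lt.2 hu)), steeper, decide_eq_true_eq, ← Nat.cast_le (α := ℝ)]
  push_cast [hu.le, hu', hw.le, hw']
  rfl

theorem upgradeSlope_le_steepest {us : List (Offer × Offer)}
    (h : ∀ u ∈ us, u.1.mass < u.2.mass ∧ u.1.cost * u.1.mass ≤ u.2.cost * u.2.mass) :
    ∀ u ∈ us, upgradeSlope u ≤ upgradeSlope (steepest us) := by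
  have aux : ∀ (d : Offer × Offer) (l : List (Offer × Offer)),
      (∀ u ∈ d :: l, u.1.mass < u.2.mass ∧ u.1.cost * u.1.mass ≤ u.2.cost * u.2.mass) →
      ∀ u ∈ l, upgradeSlope u ≤
        upgradeSlope (l.foldr (fun u w => bif steeper u w then u else w) d) := by
    intro d l
    induction l with
    | nil => simp
    | cons v l ih =>
      intro hl u hu
      have ih := ih fun u hu => hl u (by
        rcases List.mem_cons.1 hu with rfl | h <;> simp [*])
      have hmem := foldr_choose_mem steeper l d
      rw [List.foldr_cons]
      generalize l.foldr (fun u w => bif steeper u w then u else w) d = r at *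
      have hv := hl v (by simp)
      have hr := hl r (by rcases List.mem_cons.1 hmem with rfl | h <;> simp [*])
      have hs := steeper_iff hv.1 hv.2 hr.1 hr.2
      cases h : steeper v r with
      | true =>
        rcases List.mem_cons.1 hu with rfl | hu
        · exact le_rfl
        · exact (ih u hu).trans (hs.1 h)
      | false =>
        rcases List.mem_cons.1 hu with rfl | hu
        · exact (not_le.1 fun h' => by simp [hs.2 h'] at h).le
        · exact ih u hu
  cases us with
  | nil => simp
  | cons v l =>
    refine aux v (v :: l) fun u hu => h u ?_
    rcases List.mem_cons.1 hu with rfl | h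
    · simp
    · exact h

namespace Market

variable {n : ℕ} {M : Market ℚ n}

theorem upgradeSlope_offer (c : M.toReal.Choice) (i : Fin n) (o : Option (Fin (M.toReal.card i))) :
    upgradeSlope (M.offer i (c i), M.offer i o) = M.den * M.toReal.slope c i o := by
  have hD := (den_pos_real (M := M)).ne'
  simp only [upgradeSlope]
  rw [cast_offer_revenue, cast_offer_revenue, cast_offer_mass, cast_offer_mass, slope,
    ← mul_sub, ← mul_sub, sq, mul_assoc, mul_div_mul_left _ _ hD, mul_div_assoc]

/-- The algorithm replaces the current offers by those after the improvement of largest slope. -/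
theorem exists_steepest {c : M.toReal.Choice} (h : upgrades (M.slots c) ≠ []) :
    ∃ i o, M.toReal.Improves c i o ∧
      (∀ i' o', M.toReal.Improves c i' o' → M.toReal.slope c i' o' ≤ M.toReal.slope c i o) ∧
      switchTo (M.slots c) (steepest (upgrades (M.slots c))).2 =
        M.slots (Function.update c i o) := by
  obtain ⟨i, o, hu, ho⟩ := mem_upgrades_slots.1 (steepest_mem h)
  refine ⟨i, o, ho, fun i' o' ho' => ?_, by rw [hu, switchTo_slots]⟩
  have := upgradeSlope_le_steepest (us := upgrades (M.slots c)) (fun u hu => by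
      obtain ⟨x, -, -, -, h⟩ := mem_upgrades.1 hu
      exact ⟨h.1, h.2.le⟩) _ (mem_upgrades_slots.2 ⟨i', o', rfl, ho'⟩)
  rwa [hu, upgradeSlope_offer, upgradeSlope_offer, mul_le_mul_iff_right₀ den_pos_real] at this

/-- What the greedy algorithm maintains about its previous choice `b` and its current choice `c`:
the current choice is optimal for some cost and within the capacity, or it exceeds the capacity and
results from an optimal choice within the capacity by a change for one buyer. -/
def GreedyInv (M : Market ℚ n) (K : ℕ) (b c : M.toReal.Choice) : Prop :=
  (M.toReal.mass c ≤ K ∧ ∃ lam, 0 ≤ lam ∧ M.toReal.IsOptimal lam c) ∨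
  (M.toReal.mass b ≤ K ∧ K < M.toReal.mass c ∧ ∃ lam i o, 0 ≤ lam ∧ M.toReal.IsOptimal lam b ∧
    M.toReal.IsOptimal lam c ∧ c = Function.update b i o)

/-- The number of values with larger mass than the choice for their buyer. It bounds the number of
steps that the greedy algorithm can still make. -/
noncomputable def rank (M : Market ℚ n) (c : M.toReal.Choice) : ℕ :=
  ∑ i, (Finset.univ.filter fun j : Fin (M.toReal.card i) =>
    M.toReal.optionMass i (c i) < M.toReal.optionMass i (some j)).card

theorem rank_update_lt {c : M.toReal.Choice} {i : Fin n} {o : Option (Fin (M.toReal.card i))}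
    (h : M.toReal.Improves c i o) : M.rank (Function.update c i o) < M.rank c := by
  refine Finset.sum_lt_sum (fun k _ => Finset.card_le_card fun j hj => ?_)
    ⟨i, Finset.mem_univ i, Finset.card_lt_card ?_⟩
  · rw [Finset.mem_filter] at hj ⊢
    refine ⟨hj.1, lt_of_le_of_lt ?_ hj.2⟩
    by_cases hk : k = i
    · subst hk
      rw [Function.update_self]
      exact h.1.le
    · rw [Function.update_of_ne hk]
  · rw [Function.update_self]
    cases o with
    | none => exact absurd h.1 (not_lt.2 (M.toReal.optionMass_nonneg i _))
    | some j =>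
      rw [Finset.ssubset_iff_of_subset fun k hk => by
        rw [Finset.mem_filter] at hk ⊢
        exact ⟨hk.1, h.1.trans hk.2⟩]
      exact ⟨j, Finset.mem_filter.2 ⟨Finset.mem_univ _, h.1⟩, by simp⟩

theorem upgrades_slots_eq_nil {c : M.toReal.Choice} (h : M.rank c = 0) :
    upgrades (M.slots c) = [] := by
  refine List.eq_nil_iff_forall_not_mem.2 fun u hu => ?_
  obtain ⟨i, o, -, ho⟩ := mem_upgrades_slots.1 hu
  have := rank_update_lt ho
  omega

theorem exists_finalStates (M : Market ℚ n) (K : ℕ) :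
    ∃ b c : M.toReal.Choice, finalStates K M.inputList = (M.slots b, M.slots c) ∧
      M.GreedyInv K b c ∧ (K < M.toReal.mass c ∨ ∀ i o, ¬ M.toReal.Improves c i o) := by
  have hstep : ∀ b c : M.toReal.Choice, M.GreedyInv K b c →
      ((K < M.toReal.mass c ∨ upgrades (M.slots c) = []) ∧
        ascend K M.den (M.slots b, M.slots c) = (M.slots b, M.slots c)) ∨
      ∃ c', ascend K M.den (M.slots b, M.slots c) = (M.slots c, M.slots c') ∧
        M.GreedyInv K c c' ∧ M.rank c' < M.rank c := by
    intro b c hinv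
    -- Exactly the states that exceed the capacity or have no upgrade are fixed points.
    by_cases h : K < M.toReal.mass c ∨ upgrades (M.slots c) = []
    · refine Or.inl ⟨h, if_pos ?_⟩
      rwa [slotsMass_gt_iff, List.isEmpty_iff]
    · right
      have hneg : ¬ (K * M.den < slotsMass (M.slots c) ∨
          (upgrades (M.slots c)).isEmpty = true) := by
        rwa [slotsMass_gt_iff, List.isEmpty_iff]
      rw [not_or] at h
      rcases hinv with ⟨hm, lam, hlam, hc⟩ | ⟨-, hm, -⟩
      · obtain ⟨i, o, ho, hbest, hsw⟩ := exists_steepest h.2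
        obtain ⟨h₁, h₂⟩ := hc.update ho hbest
        refine ⟨Function.update c i o, (if_neg hneg).trans (by rw [hsw]), ?_, rank_update_lt ho⟩
        rcases le_or_gt (M.toReal.mass (Function.update c i o)) K with hm' | hm'
        · exact Or.inl ⟨hm', _, ho.slope_pos.le, h₂⟩
        · exact Or.inr ⟨hm, hm', _, i, o, ho.slope_pos.le, h₁, h₂, rfl⟩
      · exact absurd hm h.1
  have hlen : M.inputList.flatten.length = ∑ i, M.toReal.card i := by
    rw [List.length_flatten, inputList, List.map_ofFn, List.sum_ofFn]
    exact Finset.sum_congr rfl fun i _ => by simp [entries]; rfl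
  have key : ∀ k, ∃ b c : M.toReal.Choice,
      (ascend K M.den)^[k] (M.slots fun _ => none, M.slots fun _ => none) =
        (M.slots b, M.slots c) ∧ M.GreedyInv K b c ∧
      ((K < M.toReal.mass c ∨ upgrades (M.slots c) = []) ∨
        M.rank c + k ≤ ∑ i, M.toReal.card i) := by
    intro k
    induction k with
    | zero =>
      refine ⟨_, _, rfl, Or.inl ⟨by simp [mass, optionMass], M.toReal.exists_isOptimal_none⟩,
        Or.inr ((Nat.add_zero _).trans_le (Finset.sum_le_sum fun i _ => ?_))⟩
      exact (Finset.card_le_univ _).trans_eq (Fintype.card_fin _)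
    | succ k ih =>
      obtain ⟨b, c, he, hinv, h⟩ := ih
      rw [Function.iterate_succ_apply', he]
      rcases hstep b c hinv with ⟨hs, ha⟩ | ⟨c', ha, hinv', hr⟩
      · exact ⟨b, c, ha, hinv, Or.inl hs⟩
      · refine ⟨c, c', ha, hinv', ?_⟩
        rcases h with hs | h
        · -- A state in which the algorithm stops does not change any more.
          have : ascend K M.den (M.slots b, M.slots c) = (M.slots b, M.slots c) := by
            refine if_pos ?_
            rwa [slotsMass_gt_iff, List.isEmpty_iff]
          have e : M.slots c = M.slots c' :=
            (congrArg Prod.snd this).symm.trans (congrArg Prod.snd ha)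
          left
          rwa [← slotsMass_gt_iff, ← e, slotsMass_gt_iff]
        · exact Or.inr (by omega)
  obtain ⟨b, c, he, hinv, h⟩ := key (∑ i, M.toReal.card i)
  refine ⟨b, c, ?_, hinv, ?_⟩
  · rw [finalStates, hlen, initialSlots_inputList]
    exact he
  · have : K < M.toReal.mass c ∨ upgrades (M.slots c) = [] := by
      rcases h with h | h
      · exact h
      · exact Or.inr (upgrades_slots_eq_nil (by omega))
    refine this.imp_right fun h i o ho => ?_
    have := mem_upgrades_slots.2 ⟨i, o, rfl, ho⟩
    rw [h] at this
    exact absurd this (by simp)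

end Market

/-! ### The algorithm compares exact revenues -/

theorem listRevenue_succ {l : List (ℝ × ℝ)} {k : ℕ} (h : l.length ≤ k) :
    listRevenue (k + 1) l = listRevenue k l := by
  induction l generalizing k with
  | nil => cases k <;> rfl
  | cons o l ih =>
    rw [List.length_cons] at h
    obtain ⟨k, rfl⟩ := Nat.exists_eq_add_of_le' (by omega : 1 ≤ k)
    rw [listRevenue, listRevenue, ih (by omega : l.length ≤ k + 1), ih (by omega : l.length ≤ k)]

theorem listRevenue_min (l : List (ℝ × ℝ)) (k : ℕ) :
    listRevenue (min k l.length) l = listRevenue k l := by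
  rcases le_total k l.length with h | h
  · rw [min_eq_left h]
  · rw [min_eq_right h]
    induction k, h using Nat.le_induction with
    | base => rfl
    | succ k hk ih => rw [ih, listRevenue_succ hk]

theorem cast_revenueRow {D S : ℕ} {o : Offer} (ho : o.mass ≤ D) {G : ℕ → ℝ} (hG : G 0 = 0)
    (k : ℕ) {X : List ℕ}
    (hX : X.map (Nat.cast : ℕ → ℝ) = (List.range k).reverse.map fun m => G (m + 1)) :
    (revenueRow D S o X).map (Nat.cast : ℕ → ℝ) = (List.range k).reverse.map fun m =>
      (o.mass : ℝ) * (o.cost * S + G m) + (D - o.mass) * G (m + 1) := by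
  induction k generalizing X with
  | zero =>
    have : X = [] := by simpa using hX
    subst this
    rfl
  | succ k ih =>
    rw [List.range_succ, List.reverse_append, List.reverse_singleton, List.singleton_append,
      List.map_cons] at hX ⊢
    cases X with
    | nil => simp at hX
    | cons x X =>
      rw [List.map_cons, List.cons.injEq] at hX
      have hd : ((X.headD 0 : ℕ) : ℝ) = G k := by
        cases k with
        | zero =>
          have : X = [] := by simpa using hX.2
          rw [this, hG]
          simp
        | succ k =>
          have h := hX.2
          rw [List.range_succ, List.reverse_append, List.reverse_singleton,
            List.singleton_append, List.map_cons] at h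
          cases X with
          | nil => simp at h
          | cons y X => exact (List.cons.inj h).1
      rw [revenueRow, List.map_cons, ih hX.2]
      push_cast [ho]
      rw [hd, hX.1]

/-- The table contains the revenues, scaled by a power of `D`. -/
theorem cast_revenueTable {D k : ℕ} (hD : 0 < D) {l : List Offer} (hl : ∀ o ∈ l, o.mass ≤ D) :
    (revenueTable D (List.replicate k 0) l).1 = D ^ l.length ∧
      (revenueTable D (List.replicate k 0) l).2.map (Nat.cast : ℕ → ℝ) =
        (List.range k).reverse.map fun m => (D : ℝ) ^ (l.length + 1) *
          listRevenue (m + 1) (l.map fun o => ((o.cost : ℝ) / D, (o.mass : ℝ) / D)) := by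
  have hD' : (D : ℝ) ≠ 0 := by positivity
  induction l with
  | nil =>
    refine ⟨rfl, ?_⟩
    simp [revenueTable, listRevenue]
  | cons o l ih =>
    obtain ⟨h₁, h₂⟩ := ih fun o ho => hl o (by simp [ho])
    have h := cast_revenueRow (S := (revenueTable D (List.replicate k 0) l).1) (hl o (by simp))
      (G := fun m => (D : ℝ) ^ (l.length + 1) *
        listRevenue m (l.map fun o => ((o.cost : ℝ) / D, (o.mass : ℝ) / D)))
      (by simp [listRevenue]) k h₂
    refine ⟨?_, h.trans (List.map_congr_left fun m _ => ?_)⟩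
    · rw [List.length_cons, pow_succ', ← h₁]
      rfl
    · rw [h₁, List.map_cons, List.length_cons, listRevenue]
      push_cast
      field_simp
      ring

namespace Market

variable {n : ℕ} {M : Market ℚ n}

theorem exists_sortedOffers (c : M.toReal.Choice) : ∃ l, M.toReal.Sorted c l ∧
    sortedOffers (M.slots c) = l.map fun i => M.offer i (c i) := by
  let s : Offer → Offer → Prop := fun o o' => o'.cost ≤ o.cost
  let r : Fin n → Fin n → Prop := fun i j => s (M.offer i (c i)) (M.offer j (c j))
  have : Std.Total r := ⟨fun i j => Nat.le_total _ _⟩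
  have : IsTrans (Fin n) r := ⟨fun i j k h₁ h₂ => Nat.le_trans h₂ h₁⟩
  have hr : ∀ i j, r i j → M.toReal.optionPrice j (c j) ≤ M.toReal.optionPrice i (c i) := by
    intro i j h
    have h : (M.offer j (c j)).cost ≤ (M.offer i (c i)).cost := h
    rwa [← Nat.cast_le (α := ℝ), cast_offer_cost, cast_offer_cost,
      mul_le_mul_iff_right₀ den_pos_real] at h
  refine ⟨(List.finRange n).insertionSort r, ⟨List.perm_insertionSort r _,
    (List.pairwise_insertionSort r _).imp fun {i j} h => hr i j h⟩, ?_⟩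
  rw [List.map_insertionSort (s := s) r _ _ fun i _ j _ => Iff.rfl, sortedOffers, slots,
    List.map_ofFn, ← List.ofFn_eq_map]
  rfl

theorem cast_scaledRevenue (K : ℕ) {c : M.toReal.Choice} {l : List (Fin n)}
    (hl : M.toReal.Sorted c l) (h : sortedOffers (M.slots c) = l.map fun i => M.offer i (c i)) :
    (scaledRevenue K M.den (M.slots c) : ℝ) =
      M.den ^ (n + 1) * listRevenue K (M.toReal.choiceOffers c l) := by
  have hlen : l.length = n := by rw [hl.perm.length_eq, List.length_finRange]
  have hD := (den_pos_real (M := M)).ne'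
  have hT := (cast_revenueTable (k := min K n) M.den_pos (l := l.map fun i => M.offer i (c i))
    fun o ho => by
      obtain ⟨i, -, rfl⟩ := List.mem_map.1 ho
      rw [← Nat.cast_le (α := ℝ), cast_offer_mass]
      exact mul_le_of_le_one_right den_pos_real.le
        ((M.toReal.optionMass_le_accept i _).trans (M.toReal.accept_le_one i _))).2
  have hoff : ((l.map fun i => M.offer i (c i)).map fun o =>
      ((o.cost : ℝ) / M.den, (o.mass : ℝ) / M.den)) = M.toReal.choiceOffers c l := by
    rw [List.map_map]
    refine List.map_congr_left fun i _ => ?_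
    simp only [Function.comp_apply, cast_offer_cost, cast_offer_mass]
    rw [mul_div_cancel_left₀ _ hD, mul_div_cancel_left₀ _ hD]
  have hlen' : (M.toReal.choiceOffers c l).length = n := by rw [choiceOffers, List.length_map, hlen]
  rw [hoff, List.length_map, hlen] at hT
  rw [scaledRevenue, h, show (M.slots c).length = n by simp [slots], ← listRevenue_min, hlen']
  generalize (revenueTable M.den (List.replicate (min K n) 0)
    (l.map fun i => M.offer i (c i))).2 = X at hT
  cases hk : min K n with
  | zero =>
    rw [hk] at hT
    have : X = [] := by simpa using hT
    simp [this, listRevenue]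
  | succ k =>
    rw [hk, List.range_succ, List.reverse_append, List.reverse_singleton,
      List.singleton_append, List.map_cons] at hT
    cases X with
    | nil => simp at hT
    | cons x X => exact (List.cons.inj hT).1

/-- The output of the algorithm for a choice is a mechanism that sells at least as well as the
algorithm reckons. -/
theorem exists_spm_outputOffers (K : ℕ) (c : M.toReal.Choice) {l : List (Fin n)}
    (hl : M.toReal.Sorted c l) (h : sortedOffers (M.slots c) = l.map fun i => M.offer i (c i)) :
    ∃ S : SPM ℚ n, code (outputOffers (M.slots c)) = encodeSPM S ∧
      listRevenue K (M.toReal.choiceOffers c l) ≤ S.toReal.expectedRevenue K M.toReal := by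
  let price : Fin n → ℚ := fun i => match c i with
    | none => 0
    | some j => M.value i j
  have hnn : ∀ i, 0 ≤ price i := by
    intro i
    simp only [price]
    split
    · exact le_rfl
    · exact M.value_nonneg i _
  have hprice : ∀ i, ((price i : ℚ) : ℝ) = M.toReal.optionPrice i (c i) := by
    intro i
    simp only [price]
    cases c i with
    | none => simp [optionPrice]
    | some j => rfl
  have hcode : ∀ i, (M.offer i (c i)).price = ratPair (price i) := by
    intro i
    simp only [price]
    cases c i with
    | none => rfl
    | some j => rfl
  obtain ⟨S, hSp, hS⟩ := exists_spm_offers hl.perm hnn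
  refine ⟨S, ?_, hl.listRevenue_le K ?_⟩
  · rw [encodeSPM, hS, outputOffers, h]
    change Data.ofList _ = Data.ofList _
    rw [List.map_map, List.map_map, List.map_map]
    congr 1
    refine List.map_congr_left fun i _ => ?_
    simp only [Function.comp_apply, hcode, offer_buyer]
    rfl
  · have hcast : S.toReal.offers = S.offers.map fun o => (o.1, (o.2 : ℝ)) := by
      rw [SPM.offers, SPM.offers, List.map_ofFn]
      rfl
    rw [hcast, hS, List.map_map]
    refine List.map_congr_left fun i _ => ?_
    simp only [Function.comp_apply, hprice]

theorem exists_spm_bestOffers {K : ℕ} (hK : 1 ≤ K) (M : Market ℚ n) :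
    ∃ S : SPM ℚ n, code (bestOffers (K, M.inputList)) = encodeSPM S ∧
      ∀ A : ASPM n K, guarantee K * A.expectedRevenue M.toReal ≤
        S.toReal.expectedRevenue K M.toReal := by
  obtain ⟨b, c, he, hinv, hend⟩ := M.exists_finalStates K
  obtain ⟨l, hl, hso⟩ := exists_sortedOffers b
  obtain ⟨l', hl', hso'⟩ := exists_sortedOffers c
  obtain ⟨S, hS, hrev⟩ := exists_spm_outputOffers K b hl hso
  obtain ⟨S', hS', hrev'⟩ := exists_spm_outputOffers K c hl' hso'
  have key : ∀ A : ASPM n K, guarantee K * A.expectedRevenue M.toReal ≤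
      max (listRevenue K (M.toReal.choiceOffers b l))
        (listRevenue K (M.toReal.choiceOffers c l')) := by
    intro A
    rcases hinv with ⟨hm, lam, hlam, hc⟩ | ⟨hm, hm', lam, i, o, hlam, hb, hc, rfl⟩
    · have h₀ := hc.zero hlam (hend.resolve_left (not_lt.2 hm))
      exact (h₀.guarantee_mul_le hK hm hl' A).trans (le_max_right _ _)
    · exact hb.guarantee_mul_le_max hK hlam hc hm hm' hl hl' A
  have hcmp : scaledRevenue K M.den (M.slots b) ≤ scaledRevenue K M.den (M.slots c) ↔
      listRevenue K (M.toReal.choiceOffers b l) ≤ listRevenue K (M.toReal.choiceOffers c l') := by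
    rw [← Nat.cast_le (α := ℝ), cast_scaledRevenue K hl hso, cast_scaledRevenue K hl' hso',
      mul_le_mul_iff_right₀ (pow_pos den_pos_real _)]
  have hbest : bestOffers (K, M.inputList) =
      if scaledRevenue K M.den (M.slots b) ≤ scaledRevenue K M.den (M.slots c)
      then outputOffers (M.slots c) else outputOffers (M.slots b) := by
    rw [bestOffers, he]
    rfl
  rw [hbest]
  split_ifs with h
  · rw [hcmp] at h
    exact ⟨S', hS', fun A => (key A).trans ((max_eq_right h).le.trans hrev')⟩
  · rw [hcmp, not_le] at h
    exact ⟨S, hS, fun A => (key A).trans ((max_eq_left h.le).le.trans hrev)⟩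

end Market

/-! ### The adaptivity gap -/

theorem optSPM_le_optASPM {n : ℕ} (K : ℕ) (M : Market ℝ n) : optSPM K M ≤ optASPM K M :=
  iSup_le fun S => le_iSup_of_le (S.toASPM K) le_rfl

theorem optASPM_le {n K : ℕ} (hK : 1 ≤ K) (M : Market ℝ n) :
    optASPM K M ≤ ENNReal.ofReal (guarantee K)⁻¹ * optSPM K M := by
  obtain ⟨S, hS⟩ := Market.exists_spm_guarantee hK M
  have hg := guarantee_pos hK
  refine iSup_le fun A => ?_
  calc ENNReal.ofReal (A.expectedRevenue M)
      ≤ ENNReal.ofReal ((guarantee K)⁻¹ * S.expectedRevenue K M) :=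
        ENNReal.ofReal_le_ofReal ((le_inv_mul_iff₀ hg).2 (hS A))
    _ = ENNReal.ofReal (guarantee K)⁻¹ * ENNReal.ofReal (S.expectedRevenue K M) :=
        ENNReal.ofReal_mul (inv_nonneg.2 hg.le)
    _ ≤ _ := mul_le_mul_right (le_iSup (fun S : SPM ℝ n =>
        ENNReal.ofReal (S.expectedRevenue K M)) S) _

theorem adaptivityGap_le {K : ℕ} (hK : 1 ≤ K) :
    adaptivityGap K ≤ ENNReal.ofReal (guarantee K)⁻¹ :=
  iSup_le fun _ => iSup_le fun M => ENNReal.div_le_of_le_mul (optASPM_le hK M)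

/-- One buyer, whose value is `1`. -/
def unitMarket : Market ℝ 1 where
  card _ := 1
  value _ _ := 1
  prob _ _ := 1
  value_nonneg _ _ := zero_le_one
  value_injective _ := Function.injective_of_subsingleton _
  prob_pos _ _ := zero_lt_one
  sum_prob _ := by simp

theorem one_le_adaptivityGap {K : ℕ} (hK : 1 ≤ K) : 1 ≤ adaptivityGap K := by
  refine le_trans ?_ (le_iSup_of_le 1 (le_iSup (fun M : Market ℝ 1 => optASPM K M / optSPM K M)
    unitMarket))
  have hpos : optSPM K unitMarket ≠ 0 := by
    let S : SPM ℝ 1 := ⟨Equiv.refl _, fun _ => 1, fun _ => zero_le_one⟩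
    obtain ⟨k, rfl⟩ := Nat.exists_eq_add_of_le' hK
    have h : S.expectedRevenue (k + 1) unitMarket = 1 := by
      rw [S.expectedRevenue_eq]
      cases k <;> simp [S, SPM.offers, listRevenue, Market.accept, unitMarket] <;>
        exact Finset.card_fin 1
    refine (lt_of_lt_of_le ?_ (le_iSup (fun S : SPM ℝ 1 =>
      ENNReal.ofReal (S.expectedRevenue (k + 1) unitMarket)) S)).ne'
    simp only [h]
    simp
  have htop : optSPM K unitMarket ≠ ⊤ := by
    obtain ⟨lam, hlam, hc⟩ := unitMarket.exists_isOptimal_none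
    refine ne_top_of_le_ne_top ENNReal.ofReal_ne_top (iSup_le fun S =>
      ENNReal.ofReal_le_ofReal (hc.expectedRevenue_le hlam (S.toASPM K)))
  rw [ENNReal.le_div_iff_mul_le (Or.inl hpos) (Or.inl htop), one_mul]
  exact optSPM_le_optASPM K unitMarket

theorem tendsto_adaptivityGap : Filter.Tendsto adaptivityGap Filter.atTop (nhds 1) := by
  have hg : Filter.Tendsto guarantee Filter.atTop (nhds 1) := by
    have h : Filter.Tendsto (fun K : ℕ => 1 - 1 / Real.sqrt (2 * Real.pi * (K : ℝ)))
        Filter.atTop (nhds (1 - 0)) := by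
      refine tendsto_const_nhds.sub ?_
      simp only [one_div]
      exact tendsto_inv_atTop_zero.comp (Real.tendsto_sqrt_atTop.comp
        (tendsto_natCast_atTop_atTop.const_mul_atTop (by positivity)))
    rw [sub_zero] at h
    refine tendsto_of_tendsto_of_tendsto_of_le_of_le' h tendsto_const_nhds ?_ ?_
    · filter_upwards [Filter.eventually_ge_atTop 1] with K hK using one_sub_le_guarantee hK
    · exact Filter.Eventually.of_forall fun K => sub_le_self 1 (by positivity)
  have hu : Filter.Tendsto (fun K => ENNReal.ofReal (guarantee K)⁻¹) Filter.atTop (nhds 1) := by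
    have := ENNReal.tendsto_ofReal (hg.inv₀ one_ne_zero)
    simpa using this
  refine tendsto_of_tendsto_of_tendsto_of_le_of_le' tendsto_const_nhds hu ?_ ?_
  · filter_upwards [Filter.eventually_ge_atTop 1] with K hK using one_le_adaptivityGap hK
  · filter_upwards [Filter.eventually_ge_atTop 1] with K hK using adaptivityGap_le hK

end PostedPrice

theorem theorem2 :
    -- the approximation factor and its lower bound
    (∀ K : ℕ, 1 ≤ K →
      1 - 1 / Real.sqrt (2 * Real.pi * (K : ℝ)) ≤ PostedPrice.guarantee K) ∧
    -- an SPM with this factor against every ASPM, for real data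
    (∀ K n : ℕ, 1 ≤ K → ∀ M : PostedPrice.Market ℝ n,
      ∃ S : PostedPrice.SPM ℝ n, ∀ A : PostedPrice.ASPM n K,
        PostedPrice.guarantee K * A.expectedRevenue M ≤ S.expectedRevenue K M) ∧
    -- one program computes such an SPM for all `K` and all rational data, in time polynomial in
    -- the bit length of the input
    (∃ (P : PostedPrice.Program) (q : Polynomial ℕ),
      ∀ K n : ℕ, 1 ≤ K → ∀ M : PostedPrice.Market ℚ n,
        ∃ (S : PostedPrice.SPM ℚ n) (t : ℕ),
          P.Runs (PostedPrice.encodeInput K M) (PostedPrice.encodeSPM S) t ∧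
          t ≤ q.eval (PostedPrice.encodeInput K M).size ∧
          ∀ A : PostedPrice.ASPM n K,
            PostedPrice.guarantee K * A.expectedRevenue M.toReal ≤
              S.toReal.expectedRevenue K M.toReal) ∧
    -- the adaptivity gap vanishes
    Filter.Tendsto PostedPrice.adaptivityGap Filter.atTop (nhds 1) := by
  refine ⟨fun K hK => PostedPrice.one_sub_le_guarantee hK,
    fun K n hK M => PostedPrice.Market.exists_spm_guarantee hK M, ?_,
    PostedPrice.tendsto_adaptivityGap⟩
  obtain ⟨P, T, ⟨q, hq⟩, hP⟩ := PostedPrice.PolyTime.bestOffers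
  refine ⟨P, q, fun K n hK M => ?_⟩
  obtain ⟨S, hS, hA⟩ := PostedPrice.Market.exists_spm_bestOffers hK M
  obtain ⟨t, ht, hrun⟩ := hP (K, M.inputList)
  have hsize := hq (K, M.inputList)
  rw [hS, M.code_inputList] at hrun
  rw [PostedPrice.codeLen, M.code_inputList] at hsize
  exact ⟨S, t, hrun, ht.trans hsize, hA⟩
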